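/- **Setting.** Let $n\ge 2$ and let $\Phi^+$ be the set of positive roots of type $D_{n+1}$, with simple roots $\alpha_i=\varepsilon_i-\varepsilon_{i+1}$ $(1\le i\le n)$ and $\alpha_{n+1}=\varepsilon_n+\varepsilon_{n+1}$. Every positive root is written uniquely as $\langle a,b\rangle=\varepsilon_a+\operatorname{sgn}(b)\,\varepsilon_{|b|}$ with $1\le a<|b|\le n+1$; the integers $a$ and $b$ are its *summands*. Let $\vee$ be the diagram automorphism exchanging $n$ and $n+1$, let $\bar i$ be the $\vee$-orbit of $i$ (identified with its smallest element, so $\bar i\in\{1,\dots,n\}$), and let $*$ be the involution given by $w_0\alpha_i=-\alpha_{i^*}$. For a word $c=i_1\cdots i_n$ let $c^\vee=i_1^\vee\cdots i_n^\vee$. A *twisted adapted class* is a commutation class of reduced words of $w_0$ obtained from the class of $\prod_{k=0}^n(1\,2\cdots n)^{k\vee}$ by finitely many reflection functors $[i_1i_2\cdots i_\ell]\mapsto[i_2\cdots i_\ell i_1^*]$ and $[i_1\cdots i_{\ell-1}i_\ell]\mapsto[i_\ell^*i_1\cdots i_{\ell-1}]$. Such a class is of the form $[\mathbf i_0]=\bigl[\prod_{k=0}^n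 c^{k\vee}\bigr]$, where $c=i_1\cdots i_n$ has exactly one letter in each $\vee$-orbit (so $(s_{i_1}\cdots s_{i_n})\vee$ is a twisted Coxeter element). Fix such a $c$. Let $Q$ be the quiver of type $A_n$ on $\{1,\dots,n\}$ with an arrow $j\to i$ whenever $|i-j|=1$ and $\bar i$ occurs before $\bar j$ in $c$ (with $n+1$ read as $n$), let $a$ be the number of arrows $k+1\to k$ of $Q$ $(1\le k\le n-1)$, and let $\xi:\{1,\dots,n\}\to\mathbb Z$ be the height function with $\xi(i)=\xi(j)+1$ for every arrow $j\to i$ and $\xi(1)=2a+1$. The *twisted AR-quiver* coordinates of the positive roots are defined as follows, with $\psi=s_{i_1}\cdots s_{i_n}s_{i_1^\vee}\cdots s_{i_n^\vee}$: the root $s_{i_1}\cdots s_{i_{k-1}}(\alpha_{i_k})$ has coordinate $(i_k,\xi(\bar i_k))$; the root $s_{i_1}\cdots s_{i_n}s_{i_1^\vee}\cdots s_{i_{k-1}^\vee}(\alpha_{i_k^\vee})$ has coordinate $(i_k^\vee,\xi(\bar i_k)-2)$; and if $\beta$ and $\psi(\beta)$ are positive and $\beta$ has coordinate $(i,p)$,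 then $\psi(\beta)$ has coordinate $(i,p-4)$. A root with coordinate $(i,p)$ sits at the vertex $(\bar i,p)$ of the *folded AR-quiver* $\widehat\Upsilon_{[\mathbf i_0]}$; there are arrows $(\bar i,p)\to(\bar j,p+1)$ for $|\bar i-\bar j|=1$. The *shape* of $\widehat\Upsilon_{[\mathbf i_0]}$ is its set of vertices $Y=\{(\bar i,\xi(\bar i)-2t)\mid 1\le \bar i\le n,\ 0\le t\le n\}$. For $m\in\mathbb Z$ put $$N_m^{\rm ext}=\{(\bar i,-\bar i+2m+2(n+1)m')\in Y\mid m'\in\mathbb Z\},\qquad S_m^{\rm ext}=\{(\bar i,\bar i+2m+2(n+1)m')\in Y\mid m'\in\mathbb Z\};$$ the *$m$-snake* is $N_m^{\rm ext}\cup S_m^{\rm ext}$. It is a *$[p]$-snake* if each of its vertices is labelled by a root having $p$ or $-p$ as a summand. **Theorem 5.8.** Every twisted adapted class is of the form $\bigl[\prod_{k=0}^n c^{k\vee}\bigr]$ as above, and for every such $c$: 1. Every positive root has exactly one coordinate in the twisted AR-quiver, and sending a root to its vertex is a bijection from $\Phi^+$ onto $Y$. The roots having $n+1$ or $-(n+1)$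 as a summand are exactly those at the vertices $(\bar i,\pm \bar i)$. 2. For every $p\in\{1,\dots,n+1\}$ there is exactly one $m\in\{0,\dots,n\}$ such that the $m$-snake is a $[p]$-snake, and for every $m\in\mathbb Z$ there is exactly one $p\in\{1,\dots,n+1\}$ such that the $m$-snake is a $[p]$-snake. 3. For every $p\in\{1,\dots,n+1\}$, a positive root has $p$ or $-p$ as a summand if and only if its vertex lies in the $[p]$-snake. 4. The labels are obtained by the following algorithm, whose only inputs are the shape $Y$ and the information which of $n,n+1$ occurs in $c$. Let $N_m^{1}$ (resp. $S_m^{1}$) be the set of vertices $(\bar i,q)$ of $N_m^{\rm ext}$ (resp. $S_m^{\rm ext}$) at which $q+\bar i$ (resp. $q-\bar i$) is maximal; call $N_m^{\rm ext}$ (resp. $S_m^{\rm ext}$) connected if its vertices in consecutive residues are joined by arrows. The $m$-snake is the $[p_m]$-snake, where $$p_m=\begin{cases}n+1 & \text{if } m\equiv 0 \pmod{n+1},\\ n+1-|N_m^1| & \text{if } m\not\equiv0 \text{ and } N_m^{\rm ext}\text{ is not connected},\\ |S_m^1|+1 & \text{if } m\not\equiv0,\ N_m^{\rm ext}\text{ is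 connected and } S_m^{\rm ext}\text{ is not},\\ 1 & \text{if } m\not\equiv0\text{ and both are connected.}\end{cases}$$ The label of the vertex $v=(\bar i,q)$ is the root whose two summands are as follows. With $m=(q+\bar i)/2$, the first contribution is, for $m\not\equiv 0$, $p_m$ if $N_m^{\rm ext}$ is connected or $v\in N_m^1$, and $-p_m$ otherwise; for $m\equiv0 \pmod{n+1}$ it is $n+1$ if $n$ occurs in $c$, and $-(n+1)$ if $n+1$ occurs in $c$. With $m=(q-\bar i)/2$, the second contribution is, for $m\not\equiv0$, $p_m$ if $S_m^{\rm ext}$ is connected or $v\notin S_m^1$, and $-p_m$ otherwise; for $m\equiv0 \pmod{n+1}$ it is $-(n+1)$ if $n$ occurs in $c$, and $n+1$ if $n+1$ occurs in $c$. -/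

import Mathlib

namespace TwistedD

/-! Type `D_{n+1}` is realised with simple roots indexed by `1, …, n+1` inside the lattice spanned by
`ε_1, …, ε_{n+1}`; this lattice is kept inside the functions `ℕ → ℤ` (coordinates other than
`1, …, n+1` are never touched). Words are lists of indices. -/

/-- Ambient lattice. -/
abbrev Vec := ℕ → ℤ

/-- The vector `ε_a`. -/
def eps (a : ℕ) : Vec := Pi.single a 1

/-- For a nonzero integer `b`: the vector `ε_b` if `b > 0`, and `-ε_{|b|}` if `b < 0`. -/
def signedEps (b : ℤ) : Vec := b.sign • eps b.natAbs

/-- `⟨a, b⟩ = ε_a ± ε_{|b|}`, where the sign is the sign of `b`. -/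
def bracket (a : ℕ) (b : ℤ) : Vec := eps a + signedEps b

/-- The pairs for which `⟨a, b⟩` is a positive root of type `D_{n+1}`. -/
def IsRootPair (n a : ℕ) (b : ℤ) : Prop := 1 ≤ a ∧ a < b.natAbs ∧ b.natAbs ≤ n + 1

/-- Positive roots `⟨a, b⟩`, `1 ≤ a < |b| ≤ n+1`. -/
def IsPosRoot (n : ℕ) (β : Vec) : Prop := ∃ a b, IsRootPair n a b ∧ β = bracket a b

/-- `p` is the first or the second summand of the positive root `β = ⟨a, b⟩`. -/
def IsSummand (n : ℕ) (β : Vec) (p : ℤ) : Prop :=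
  ∃ (a : ℕ) (b : ℤ), IsRootPair n a b ∧ β = bracket a b ∧ (p = a ∨ p = b)

/-- `α_i = ε_i - ε_{i+1}` for `i ≤ n`, and `α_{n+1} = ε_n + ε_{n+1}`. -/
def simpleRoot (n i : ℕ) : Vec :=
  if i = n + 1 then eps n + eps (n + 1) else eps i - eps (i + 1)

/-- The scalar product `(v, α_i)`. -/
def pairing (n i : ℕ) (v : Vec) : ℤ :=
  if i = n + 1 then v n + v (n + 1) else v i - v (i + 1)

/-- The simple reflection `s_i`. -/
def reflection (n i : ℕ) (v : Vec) : Vec := v - pairing n i v • simpleRoot n i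

/-- The action of `s_{i_1} s_{i_2} ⋯ s_{i_l}` for the word `i_1 i_2 ⋯ i_l`. -/
def wordAct (n : ℕ) (w : List ℕ) (v : Vec) : Vec := w.foldr (reflection n) v

/-- The diagram automorphism `∨`, which swaps `n` and `n+1`. -/
def vee (n i : ℕ) : ℕ := if i = n then n + 1 else if i = n + 1 then n else i

/-- The involution `*` given by `w_0 α_i = -α_{i*}`: it is trivial for `D_{n+1}` with `n+1` even,
and it is `∨` for `n+1` odd. -/
def star (n i : ℕ) : ℕ := if Even (n + 1) then i else vee n i

/-- The orbit of `i` under `∨`, named by its smallest element in `{1, …, n}`. -/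
def fold (n i : ℕ) : ℕ := if i = n + 1 then n else i

/-- Adjacency in the Dynkin diagram of type `D_{n+1}`. -/
def DAdj (n i j : ℕ) : Prop :=
  (j = i + 1 ∧ j ≤ n) ∨ (i = j + 1 ∧ i ≤ n) ∨
    (i + 1 = n ∧ j = n + 1) ∨ (i = n + 1 ∧ j + 1 = n)

/-- One commutation relation `s_i s_j = s_j s_i`. -/
inductive CommStep (n : ℕ) : List ℕ → List ℕ → Prop
  | swap (u v : List ℕ) (i j : ℕ) (hij : i ≠ j) (h : ¬ DAdj n i j) :
      CommStep n (u ++ i :: j :: v) (u ++ j :: i :: v)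

/-- Commutation equivalence of words; its classes are the commutation classes. -/
def CommEquiv (n : ℕ) : List ℕ → List ℕ → Prop := Relation.EqvGen (CommStep n)

/-- `∏_{k=0}^{n} (c)^{k∨}`: the concatenation of `c, c^∨, c^{∨∨}, …` (`n+1` blocks). -/
def twistedWord (n : ℕ) (c : List ℕ) : List ℕ :=
  (List.range (n + 1)).flatMap (fun k => c.map (vee n)^[k])

/-- The commutation class of the word is twisted adapted: it lies in the `r`-cluster point of
`∏_{k=0}^{n} (1 2 ⋯ n)^{k∨}`, i.e. it is reached from there by right and left reflection functors
on commutation classes. -/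
inductive IsTwistedAdapted (n : ℕ) : List ℕ → Prop
  | base : IsTwistedAdapted n (twistedWord n (List.range' 1 n))
  | comm {w w' : List ℕ} : IsTwistedAdapted n w → CommEquiv n w w' → IsTwistedAdapted n w'
  | sink {i : ℕ} {w : List ℕ} : IsTwistedAdapted n (i :: w) → IsTwistedAdapted n (w ++ [star n i])
  | source {i : ℕ} {w : List ℕ} :
      IsTwistedAdapted n (w ++ [i]) → IsTwistedAdapted n (star n i :: w)

/-- `c = i_1 ⋯ i_n` has exactly one letter from each `∨`-orbit, i.e. `(s_{i_1} ⋯ s_{i_n})∨` is a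
twisted Coxeter element. -/
def IsTwistedCoxeterWord (n : ℕ) (c : List ℕ) : Prop :=
  (c.map (fold n)).Perm (List.range' 1 n)

/-- The Dynkin quiver `Q` of type `A_n` attached to `c`: the one to which the Coxeter word
obtained from `c` by replacing `n+1` by `n` is adapted (its letters are successively sinks). There
is an arrow `j → i` when `i`, `j` are neighbours and `i` occurs before `j`. -/
def QArrow (n : ℕ) (c : List ℕ) (j i : ℕ) : Prop :=
  (i + 1 = j ∨ j + 1 = i) ∧ 1 ≤ i ∧ i ≤ n ∧ 1 ≤ j ∧ j ≤ n ∧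
    (c.map (fold n)).idxOf i < (c.map (fold n)).idxOf j

instance (n : ℕ) (c : List ℕ) (j i : ℕ) : Decidable (QArrow n c j i) := by
  unfold QArrow; infer_instance

/-- The number of arrows of `Q` directed toward `1`. -/
def arrowsToOne (n : ℕ) (c : List ℕ) : ℕ :=
  ((Finset.Icc 1 (n - 1)).filter (fun k => QArrow n c (k + 1) k)).card

/-- The normalised height function on the folded index set `{1, …, n}`. -/
def IsHeight (n : ℕ) (c : List ℕ) (ξ : ℕ → ℤ) : Prop :=
  (∀ i j, QArrow n c j i → ξ i = ξ j + 1) ∧ ξ 1 = 2 * (arrowsToOne n c : ℤ) + 1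

/-- `HasCoord n c ξ β i p`: in the twisted AR-quiver of the class of `∏_{k=0}^{n} (c)^{k∨}` the
positive root `β` has the coordinate `(i, p)`. Here `c ++ c.map (vee n)` is a word of
`ψ = s_{i_1} ⋯ s_{i_n} s_{i_1^∨} ⋯ s_{i_n^∨}`. -/
inductive HasCoord (n : ℕ) (c : List ℕ) (ξ : ℕ → ℤ) : Vec → ℕ → ℤ → Prop
  | first (u v : List ℕ) (i : ℕ) (h : c = u ++ i :: v) :
      HasCoord n c ξ (wordAct n u (simpleRoot n i)) i (ξ (fold n i))
  | second (u v : List ℕ) (i : ℕ) (h : c = u ++ i :: v) :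
      HasCoord n c ξ (wordAct n (c ++ u.map (vee n)) (simpleRoot n (vee n i))) (vee n i)
        (ξ (fold n i) - 2)
  | next (β : Vec) (i : ℕ) (p : ℤ) (h : HasCoord n c ξ β i p) (hβ : IsPosRoot n β)
      (hψ : IsPosRoot n (wordAct n (c ++ c.map (vee n)) β)) :
      HasCoord n c ξ (wordAct n (c ++ c.map (vee n)) β) i (p - 4)

/-- `β` sits at the vertex `v = (ī, p)` of the folded AR-quiver. -/
def HasFoldedCoord (n : ℕ) (c : List ℕ) (ξ : ℕ → ℤ) (β : Vec) (v : ℕ × ℤ) : Prop :=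
  ∃ i, HasCoord n c ξ β i v.2 ∧ fold n i = v.1

/-- The shape of the folded AR-quiver: the coordinates `(ī, ξ(ī) - 2t)`, `0 ≤ t ≤ n`. -/
def shape (n : ℕ) (ξ : ℕ → ℤ) : Finset (ℕ × ℤ) :=
  (Finset.Icc 1 n ×ˢ Finset.range (n + 1)).image (fun x => (x.1, ξ x.1 - 2 * (x.2 : ℤ)))

/-- Arrows `(ī, p) → (j̄, p+1)`, `|i - j| = 1`, between vertices of the folded AR-quiver. -/
def FoldedArrow (u v : ℕ × ℤ) : Prop := (u.1 + 1 = v.1 ∨ v.1 + 1 = u.1) ∧ v.2 = u.2 + 1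

instance (u v : ℕ × ℤ) : Decidable (FoldedArrow u v) := by
  unfold FoldedArrow; infer_instance

/-- Vertices of the `N_m^ext`-sectional quiver in a shape `Y`:
the `(ī, -i + 2m + 2(n+1)m')` in `Y`, `m' ∈ ℤ`. -/
def nExt (n : ℕ) (Y : Finset (ℕ × ℤ)) (m : ℤ) : Finset (ℕ × ℤ) :=
  Y.filter (fun v => (2 * ((n : ℤ) + 1)) ∣ v.2 - (-(v.1 : ℤ) + 2 * m))

/-- Vertices of the `S_m^ext`-sectional quiver in a shape `Y`:
the `(ī, i + 2m + 2(n+1)m')` in `Y`, `m' ∈ ℤ`. -/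
def sExt (n : ℕ) (Y : Finset (ℕ × ℤ)) (m : ℤ) : Finset (ℕ × ℤ) :=
  Y.filter (fun v => (2 * ((n : ℤ) + 1)) ∣ v.2 - ((v.1 : ℤ) + 2 * m))

/-- The `m`-snake. -/
def snake (n : ℕ) (Y : Finset (ℕ × ℤ)) (m : ℤ) : Finset (ℕ × ℤ) := nExt n Y m ∪ sExt n Y m

/-- The `m`-snake is the `[p]`-snake: each of its vertices has `p` or `-p` as a summand. -/
def IsSnakeOf (n : ℕ) (c : List ℕ) (ξ : ℕ → ℤ) (p : ℕ) (m : ℤ) : Prop :=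
  ∀ v ∈ snake n (shape n ξ) m, ∀ β, IsPosRoot n β → HasFoldedCoord n c ξ β v →
    IsSummand n β p ∨ IsSummand n β (-(p : ℤ))

/-! The labelling algorithm. Its only inputs are the shape `Y` and one bit, which says whether `n`
or `n+1` occurs in the twisted Coxeter element. -/

/-- Connectedness of an extended sectional quiver (a full subquiver with one vertex in each folded
residue): vertices in consecutive residues are joined by an arrow. -/
def IsConn (A : Finset (ℕ × ℤ)) : Prop :=
  ∀ u ∈ A, ∀ v ∈ A, u.1 + 1 = v.1 → FoldedArrow u v ∨ FoldedArrow v u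

instance (A : Finset (ℕ × ℤ)) : Decidable (IsConn A) := by
  unfold IsConn; infer_instance

/-- The right part of the `N_m^ext`-sectional quiver: the rightmost of the `N`-sectional paths
(`i + p` constant) of which it consists. -/
def nRight (n : ℕ) (Y : Finset (ℕ × ℤ)) (m : ℤ) : Finset (ℕ × ℤ) :=
  (nExt n Y m).filter (fun v => ∀ u ∈ nExt n Y m, u.2 + (u.1 : ℤ) ≤ v.2 + (v.1 : ℤ))

/-- The right part of the `S_m^ext`-sectional quiver: the rightmost of the `S`-sectional paths
(`p - i` constant) of which it consists. -/
def sRight (n : ℕ) (Y : Finset (ℕ × ℤ)) (m : ℤ) : Finset (ℕ × ℤ) :=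
  (sExt n Y m).filter (fun v => ∀ u ∈ sExt n Y m, u.2 - (u.1 : ℤ) ≤ v.2 - (v.1 : ℤ))

/-- The number `p` such that the `m`-snake is the `[p]`-snake, read off from the shape. -/
def snakeNumber (n : ℕ) (Y : Finset (ℕ × ℤ)) (m : ℤ) : ℕ :=
  if ((n : ℤ) + 1) ∣ m then n + 1
  else if ¬ IsConn (nExt n Y m) then n + 1 - (nRight n Y m).card
  else if ¬ IsConn (sExt n Y m) then (sRight n Y m).card + 1
  else 1

/-- The summand that the vertex `v` receives from the `N_m^ext`-sectional quiver through it. -/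
def nSummand (n : ℕ) (Y : Finset (ℕ × ℤ)) (hasN : Bool) (m : ℤ) (v : ℕ × ℤ) : ℤ :=
  if ((n : ℤ) + 1) ∣ m then (if hasN then (n : ℤ) + 1 else -((n : ℤ) + 1))
  else if IsConn (nExt n Y m) ∨ v ∈ nRight n Y m then (snakeNumber n Y m : ℤ)
  else -(snakeNumber n Y m : ℤ)

/-- The summand that the vertex `v` receives from the `S_m^ext`-sectional quiver through it. -/
def sSummand (n : ℕ) (Y : Finset (ℕ × ℤ)) (hasN : Bool) (m : ℤ) (v : ℕ × ℤ) : ℤ :=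
  if ((n : ℤ) + 1) ∣ m then (if hasN then -((n : ℤ) + 1) else (n : ℤ) + 1)
  else if IsConn (sExt n Y m) ∨ v ∉ sRight n Y m then (snakeNumber n Y m : ℤ)
  else -(snakeNumber n Y m : ℤ)

/-- The unordered pair of summands which the algorithm puts at the vertex `v = (ī, p)`; this vertex
lies in the `N_m^ext`-sectional quiver for `m = (p + i)/2` and in the `S_m^ext`-sectional quiver for
`m = (p - i)/2`. -/
def label (n : ℕ) (Y : Finset (ℕ × ℤ)) (hasN : Bool) (v : ℕ × ℤ) : ℤ × ℤ :=
  (nSummand n Y hasN ((v.2 + (v.1 : ℤ)) / 2) v, sSummand n Y hasN ((v.2 - (v.1 : ℤ)) / 2) v)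

end TwistedD

/-! Write the height function as `ξ i = 2 * d i + i`. A vertex `(i, q)` lies on the N-path of index
`(q + i) / 2` and on the S-path of index `(q - i) / 2`. All labels come from one map `E : ℤ → Vec`
with values `±ε_j` and `E (m + (n + 1)) = -E m`: the root at `(i, q)` is `E ((q + i) / 2) - E ((q -
i) / 2)`. Indices congruent modulo `n + 1` carry the same `ε_j` up to sign, and this is what glues
sectional paths into a snake.

Such an `E` (`IsLabelling`) is governed by `d` and by a sign `s` recording which of `n`, `n + 1`
comes next. If `l` is a sink of the type prescribed by `s`, then `α_l` is a difference of two values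
of `E`, and `s_l ∘ E` is a labelling for the height function lowered at `l` (`IsLabelling.fire`).
Iterating gives the roots along a word (`IsLabelling.wordAct_simpleRoot`). After `c c^∨` every `d i`
has dropped by 2 and the sign is restored, so `ψ (E m) = E (m - 2)` (`SnakeData.wordAct_double`).

Since `d` is weakly decreasing and `d i + i` weakly increasing, the condition that places residue
`i` on one path of the `r`-snake or the other changes at a single threshold `e r`. This threshold is
the snake number, and `e` is inverse to `snakePos` on `[0, n]`. It yields positivity of the roots
(`SnakeData.isPosRoot_root`); injectivity and surjectivity are congruences modulo `2 (n + 1)`. The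
algorithm reads `e r` off as the size of a right part, and the signs off the side of the threshold.

That every twisted adapted class comes from some `c` is independent word combinatorics: a sink
functor moves a letter from the front of `c` to its end as its `∨`-image
(`IsTwistedCoxeterWord.exists_sink`), and reversal turns sources into sinks. -/

namespace TwistedD

/-! ### Words, commutation classes and the diagram automorphism -/

theorem vee_vee (n i : ℕ) : vee n (vee n i) = i := by
  unfold vee; split_ifs <;> omega

theorem vee_involutive (n : ℕ) : Function.Involutive (vee n) := vee_vee n

theorem fold_vee (n i : ℕ) : fold n (vee n i) = fold n i := by
  unfold fold vee; split_ifs <;> omega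

theorem fold_vee_iterate (n k i : ℕ) : fold n ((vee n)^[k] i) = fold n i := by
  induction k generalizing i with
  | zero => rfl
  | succ k ih => rw [Function.iterate_succ_apply, ih, fold_vee]

theorem star_eq_iterate (n i : ℕ) : star n i = (vee n)^[n + 1] i := by
  unfold star
  split_ifs with h
  · rw [(vee_involutive n).iterate_even h]; rfl
  · rw [(vee_involutive n).iterate_odd (Nat.not_even_iff_odd.mp h)]

theorem dAdj_symm {n i j : ℕ} (h : DAdj n i j) : DAdj n j i := by
  unfold DAdj at *; omega

theorem dAdj_vee {n i j : ℕ} : DAdj n (vee n i) (vee n j) ↔ DAdj n i j := by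
  unfold DAdj vee; split_ifs <;> omega

theorem CommEquiv.refl (n : ℕ) (w : List ℕ) : CommEquiv n w w := Relation.EqvGen.refl w

theorem CommEquiv.symm {n : ℕ} {w w' : List ℕ} (h : CommEquiv n w w') : CommEquiv n w' w :=
  Relation.EqvGen.symm _ _ h

theorem CommEquiv.trans {n : ℕ} {a b c : List ℕ} (h : CommEquiv n a b) (h' : CommEquiv n b c) :
    CommEquiv n a c := Relation.EqvGen.trans _ _ _ h h'

theorem CommStep.commEquiv {n : ℕ} {w w' : List ℕ} (h : CommStep n w w') : CommEquiv n w w' :=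
  Relation.EqvGen.rel _ _ h

/-- A map on words that sends elementary commutations to equivalences respects equivalence. -/
theorem CommEquiv.lift {n : ℕ} (f : List ℕ → List ℕ)
    (hf : ∀ a b, CommStep n a b → CommEquiv n (f a) (f b)) {w w' : List ℕ}
    (h : CommEquiv n w w') : CommEquiv n (f w) (f w') := by
  induction h with
  | rel a b h => exact hf a b h
  | refl a => exact .refl _ _
  | symm a b _ ih => exact ih.symm
  | trans a b c _ _ ih ih' => exact ih.trans ih'

/-- A function on words that is constant along elementary commutations is a class invariant. -/
theorem CommEquiv.invariant {n : ℕ} {α : Sort*} (f : List ℕ → α)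
    (hf : ∀ a b, CommStep n a b → f a = f b) {w w' : List ℕ}
    (h : CommEquiv n w w') : f w = f w' := by
  induction h with
  | rel a b h => exact hf a b h
  | refl a => rfl
  | symm a b _ ih => exact ih.symm
  | trans a b c _ _ ih ih' => exact ih.trans ih'

theorem CommEquiv.append {n : ℕ} {a b : List ℕ} (x y : List ℕ) (h : CommEquiv n a b) :
    CommEquiv n (x ++ a ++ y) (x ++ b ++ y) := by
  refine CommEquiv.lift (fun w => x ++ w ++ y) ?_ h
  rintro _ _ ⟨u, v, i, j, hij, h⟩
  have := (CommStep.swap (n := n) (x ++ u) (v ++ y) i j hij h).commEquiv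
  simpa using this

theorem CommEquiv.append₂ {n : ℕ} {a b a' b' : List ℕ} (h : CommEquiv n a b)
    (h' : CommEquiv n a' b') : CommEquiv n (a ++ a') (b ++ b') := by
  have h1 := h.append [] a'
  have h2 := h'.append b []
  simp only [List.nil_append, List.append_nil] at h1 h2
  exact h1.trans h2

theorem CommEquiv.reverse {n : ℕ} {a b : List ℕ} (h : CommEquiv n a b) :
    CommEquiv n a.reverse b.reverse := by
  refine CommEquiv.lift List.reverse ?_ h
  rintro _ _ ⟨u, v, i, j, hij, h⟩
  have := (CommStep.swap (n := n) v.reverse u.reverse j i hij.symm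
    (fun h' => h (dAdj_symm h'))).commEquiv
  simpa using this

theorem CommEquiv.map_vee {n : ℕ} {a b : List ℕ} (h : CommEquiv n a b) :
    CommEquiv n (a.map (vee n)) (b.map (vee n)) := by
  refine CommEquiv.lift (List.map (vee n)) ?_ h
  rintro _ _ ⟨u, v, i, j, hij, h⟩
  have := (CommStep.swap (n := n) (u.map (vee n)) (v.map (vee n)) (vee n i) (vee n j)
    (fun h' => hij ((vee_involutive n).injective h')) (fun h' => h (dAdj_vee.mp h'))).commEquiv
  simpa using this

theorem CommEquiv.map_vee_iterate {n : ℕ} {a b : List ℕ} (h : CommEquiv n a b) (k : ℕ) :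
    CommEquiv n (a.map (vee n)^[k]) (b.map (vee n)^[k]) := by
  induction k generalizing a b with
  | zero => simpa using h
  | succ k ih =>
    rw [Function.iterate_succ, ← List.map_map, ← List.map_map]
    exact ih h.map_vee

/-- Serves as left cancellation: erasing a common first letter keeps two words equivalent. -/
theorem CommEquiv.erase {n : ℕ} {a b : List ℕ} (l : ℕ) (h : CommEquiv n a b) :
    CommEquiv n (a.erase l) (b.erase l) := by
  refine CommEquiv.lift (fun w => w.erase l) ?_ h
  rintro _ _ ⟨u, v, i, j, hij, h⟩
  by_cases hu : l ∈ u
  · rw [List.erase_append_left _ hu, List.erase_append_left _ hu]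
    exact (CommStep.swap _ _ i j hij h).commEquiv
  · rw [List.erase_append_right _ hu, List.erase_append_right _ hu]
    by_cases hi : i = l
    · subst hi
      rw [List.erase_cons_head, List.erase_cons_tail (by simpa using hij.symm),
        List.erase_cons_head]
      exact .refl _ _
    · by_cases hj : j = l
      · subst hj
        rw [List.erase_cons_head, List.erase_cons_tail (by simpa using hij), List.erase_cons_head]
        exact .refl _ _
      · rw [List.erase_cons_tail (by simpa using hi), List.erase_cons_tail (by simpa using hj),
          List.erase_cons_tail (by simpa using hj), List.erase_cons_tail (by simpa using hi)]
        exact (CommStep.swap _ _ i j hij h).commEquiv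

theorem CommEquiv.mem_iff {n : ℕ} {a b : List ℕ} (h : CommEquiv n a b) (x : ℕ) :
    x ∈ a ↔ x ∈ b := by
  refine iff_of_eq (CommEquiv.invariant (fun w => x ∈ w) ?_ h)
  rintro _ _ ⟨u, v, i, j, hij, h⟩
  simp only [List.mem_append, List.mem_cons, eq_iff_iff]
  tauto

/-- A swap involves distinct commuting letters, so at most one of them survives the projection onto
two adjacent letters. -/
theorem CommEquiv.filter_eq {n i x : ℕ} (hx : DAdj n i x) {a b : List ℕ} (h : CommEquiv n a b) :
    a.filter (fun y => y = i ∨ y = x) = b.filter (fun y => y = i ∨ y = x) := by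
  refine CommEquiv.invariant (fun w => w.filter (fun y => y = i ∨ y = x)) ?_ h
  rintro _ _ ⟨u, v, k, j, hij, h⟩
  simp only [List.filter_append, List.filter_cons, decide_eq_true_eq]
  congr 1
  split_ifs with h1 h2 h2
  · exfalso
    rcases h1 with rfl | rfl <;> rcases h2 with rfl | rfl
    · exact hij rfl
    · exact h hx
    · exact h (dAdj_symm hx)
    · exact hij rfl
  all_goals rfl

/-- Letters preceding the first occurrence of a letter which can be moved to the front
commute with it. -/
theorem CommEquiv.not_dAdj_of_mem {n i : ℕ} {w u v : List ℕ}
    (h : CommEquiv n (i :: w) (u ++ i :: v)) (hi : i ∉ u) {x : ℕ} (hx : x ∈ u) : ¬ DAdj n i x := by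
  intro had
  -- Projected onto `{i, x}`, the left word starts with `i` and the right word with `x`.
  have hf := h.filter_eq had
  obtain ⟨u₁, u₂, rfl⟩ := List.append_of_mem hx
  have hu : ∀ y ∈ (u₁ ++ x :: u₂).filter (fun y => y = i ∨ y = x), y = x := by
    intro y hy
    simp only [List.mem_filter, decide_eq_true_eq] at hy
    rcases hy with ⟨hy, rfl | rfl⟩
    · exact absurd hy hi
    · rfl
  have hxm : x ∈ (u₁ ++ x :: u₂).filter (fun y => y = i ∨ y = x) := by simp
  rw [List.filter_append, List.filter_cons, if_pos (by simp)] at hf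
  cases hl : (u₁ ++ x :: u₂).filter (fun y => y = i ∨ y = x) with
  | nil => rw [hl] at hxm; simp at hxm
  | cons y l =>
    rw [hl] at hf hu
    simp only [List.cons_append, List.cons.injEq] at hf
    have := hu y (by simp)
    exact hi (by rw [hf.1, this]; simp)

theorem commEquiv_move_front {n i : ℕ} (u v : List ℕ) (h : ∀ x ∈ u, x ≠ i ∧ ¬ DAdj n x i) :
    CommEquiv n (u ++ i :: v) (i :: (u ++ v)) := by
  induction u with
  | nil => exact .refl _ _
  | cons x u ih =>
    have h1 := (ih fun y hy => h y (by simp [hy])).append [x] []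
    simp only [List.cons_append, List.nil_append, List.append_nil] at h1 ⊢
    exact h1.trans (CommStep.swap [] (u ++ v) x i (h x (by simp)).1 (h x (by simp)).2).commEquiv

/-! ### Twisted words under reflection functors -/

theorem CommEquiv.twistedWord {n : ℕ} {a b : List ℕ} (h : CommEquiv n a b) :
    CommEquiv n (twistedWord n a) (twistedWord n b) := by
  unfold TwistedD.twistedWord
  induction n + 1 with
  | zero => exact .refl _ _
  | succ N ih =>
    rw [List.range_succ, List.flatMap_append, List.flatMap_append]
    exact ih.append₂ (by simpa using h.map_vee_iterate N)

/-- Because `*` is the `(n + 1)`-st power of `∨`, the appended letter is what a further block would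
start with. Regrouping, the first letter of each block becomes the last letter of the preceding one.
-/
theorem twistedWord_rotate (n i : ℕ) (x : List ℕ) :
    twistedWord n (i :: x) ++ [star n i] = i :: twistedWord n (x ++ [vee n i]) := by
  rw [star_eq_iterate]
  unfold twistedWord
  generalize n + 1 = N
  induction N with
  | zero => simp
  | succ N ih =>
    rw [List.range_succ, List.flatMap_append, List.flatMap_append, ← List.cons_append, ← ih]
    simp [Function.iterate_succ_apply]

/-- Reversal preserves the family of twisted words, which reduces the source functor to the sink
functor. Block `k` becomes block `n - k`, and `n - k` and `n + k` have the same parity. -/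
theorem twistedWord_reverse (n : ℕ) (c : List ℕ) :
    (twistedWord n c).reverse = twistedWord n ((c.map (vee n)^[n]).reverse) := by
  unfold twistedWord
  rw [List.reverse_flatMap]
  have : (List.range (n + 1)).reverse = (List.range (n + 1)).map (fun k => n - k) := by
    apply List.ext_getElem
    · simp
    · intro k h1 h2
      simp at h1 ⊢
  rw [this, List.flatMap_map]
  refine List.flatMap_congr fun k hk => ?_
  have hk : k ≤ n := by simpa [Nat.lt_succ_iff] using hk
  simp only [Function.comp_apply, List.map_reverse, List.map_map]
  congr 2
  funext x
  have : (vee n)^[2 * k] = id := (vee_involutive n).iterate_two_mul k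
  rw [Function.comp_apply, ← Function.iterate_add_apply, show k + n = (n - k) + 2 * k by omega,
    Function.iterate_add_apply, this, id]

theorem mem_twistedWord_fold {n i : ℕ} {c : List ℕ} (h : i ∈ twistedWord n c) :
    ∃ k ∈ c, fold n k = fold n i := by
  unfold twistedWord at h
  simp only [List.mem_flatMap, List.mem_map] at h
  obtain ⟨t, _, k, hk, rfl⟩ := h
  exact ⟨k, hk, (fold_vee_iterate n t k).symm⟩

theorem twistedWord_prefix (n : ℕ) (c : List ℕ) : ∃ r, twistedWord n c = c ++ r := by
  unfold twistedWord
  rw [List.range_succ_eq_map]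
  simp

theorem IsTwistedCoxeterWord.mem_fold {n : ℕ} {c : List ℕ} (hc : IsTwistedCoxeterWord n c)
    (i : ℕ) : i ∈ c.map (fold n) ↔ 1 ≤ i ∧ i ≤ n := by
  rw [hc.mem_iff, List.mem_range'_1]; omega

theorem IsTwistedCoxeterWord.exists_sink {n : ℕ} (hn : 2 ≤ n) {c w : List ℕ} {i : ℕ}
    (hc : IsTwistedCoxeterWord n c) (h : CommEquiv n (i :: w) (twistedWord n c)) :
    ∃ c', IsTwistedCoxeterWord n c' ∧ CommEquiv n (w ++ [star n i]) (twistedWord n c') := by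
  have hi : i ∈ twistedWord n c := (h.mem_iff i).mp (by simp)
  obtain ⟨r, hr⟩ := twistedWord_prefix n c
  by_cases hic : i ∈ c
  · obtain ⟨u, v, rfl, hiu⟩ := List.eq_append_cons_of_mem hic
    have hcomm : ∀ x ∈ u, x ≠ i ∧ ¬ DAdj n x i := by
      intro x hx
      refine ⟨fun hxi => hiu (hxi ▸ hx), fun had => ?_⟩
      rw [hr, List.append_assoc, List.cons_append] at h
      exact h.not_dAdj_of_mem hiu hx (dAdj_symm had)
    have h1 := h.trans (commEquiv_move_front u v hcomm).twistedWord
    refine ⟨u ++ v ++ [vee n i], ?_, ?_⟩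
    · refine List.Perm.trans ?_ hc
      simp only [List.map_append, List.map_cons, List.map_nil, fold_vee, List.append_assoc]
      exact List.Perm.append_left _ List.perm_append_comm
    · have h2 := h1.append [] [star n i]
      rw [List.nil_append, List.nil_append, twistedWord_rotate] at h2
      simpa using h2.erase i
  -- Here `i` is the element of `{n, n + 1}` missing from `c`. All its occurrences come after the
  -- letter `n - 1` of `c`, which is adjacent to it, so `i` cannot be moved to the front.
  · exfalso
    rw [hr, List.mem_append] at hi
    obtain ⟨u, v, rfl, hiu⟩ := List.eq_append_cons_of_mem (hi.resolve_left hic)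
    obtain ⟨k, hk, hki⟩ := mem_twistedWord_fold ((h.mem_iff i).mp (by simp))
    have hne : k ≠ i := fun h' => hic (h' ▸ hk)
    have hin : i = n ∨ i = n + 1 := by
      unfold fold at hki; split_ifs at hki <;> omega
    obtain ⟨y, hy, hyn⟩ := List.mem_map.mp ((hc.mem_fold (n - 1)).mpr (by omega))
    have hyn : y = n - 1 := by unfold fold at hyn; split_ifs at hyn <;> omega
    rw [hr, ← List.append_assoc] at h
    refine h.not_dAdj_of_mem (by simp [hic, hiu]) (List.mem_append_left u hy) ?_
    unfold DAdj; omega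

theorem IsTwistedCoxeterWord.reverse {n : ℕ} {c : List ℕ} (hc : IsTwistedCoxeterWord n c) :
    IsTwistedCoxeterWord n ((c.map (vee n)^[n]).reverse) := by
  refine List.Perm.trans ?_ hc
  rw [List.map_reverse, List.map_map]
  have : fold n ∘ (vee n)^[n] = fold n := funext (fold_vee_iterate n n)
  rw [this]
  exact List.reverse_perm _

theorem IsTwistedAdapted.exists_coxeter {n : ℕ} (hn : 2 ≤ n) {w : List ℕ}
    (hw : IsTwistedAdapted n w) :
    ∃ c, IsTwistedCoxeterWord n c ∧ CommEquiv n w (twistedWord n c) := by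
  induction hw with
  | base =>
    refine ⟨_, ?_, .refl _ _⟩
    have : (List.range' 1 n).map (fold n) = List.range' 1 n := by
      conv_rhs => rw [← List.map_id (List.range' 1 n)]
      refine List.map_congr_left fun x hx => ?_
      rw [List.mem_range'_1] at hx
      simp only [fold, id]; split_ifs <;> omega
    unfold IsTwistedCoxeterWord
    rw [this]
  | comm _ h ih =>
    obtain ⟨c, hc, h'⟩ := ih
    exact ⟨c, hc, h.symm.trans h'⟩
  | sink _ ih =>
    obtain ⟨c, hc, h⟩ := ih
    exact hc.exists_sink hn h
  | source _ ih =>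
    obtain ⟨c, hc, h⟩ := ih
    have h := h.reverse
    rw [twistedWord_reverse, List.reverse_append] at h
    obtain ⟨c', hc', h'⟩ := hc.reverse.exists_sink hn h
    refine ⟨_, hc'.reverse, ?_⟩
    rw [← twistedWord_reverse]
    simpa using h'.reverse

/-! ### Simple reflections on the lattice -/

theorem eps_apply (a x : ℕ) : eps a x = if x = a then 1 else 0 := by
  simp [eps, Pi.single_apply]

theorem reflection_add (n l : ℕ) (v w : Vec) :
    reflection n l (v + w) = reflection n l v + reflection n l w := by
  funext x
  simp only [reflection, pairing, Pi.add_apply, Pi.sub_apply, Pi.smul_apply, smul_eq_mul]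
  split_ifs <;> ring

theorem reflection_smul (n l : ℕ) (k : ℤ) (v : Vec) :
    reflection n l (k • v) = k • reflection n l v := by
  funext x
  simp only [reflection, pairing, Pi.sub_apply, Pi.smul_apply, smul_eq_mul]
  split_ifs <;> ring

theorem reflection_neg (n l : ℕ) (v : Vec) : reflection n l (-v) = -reflection n l v := by
  simpa using reflection_smul n l (-1) v

theorem reflection_sub (n l : ℕ) (v w : Vec) :
    reflection n l (v - w) = reflection n l v - reflection n l w := by
  rw [sub_eq_add_neg, reflection_add, reflection_neg, ← sub_eq_add_neg]

theorem pairing_simpleRoot (n l : ℕ) : pairing n l (simpleRoot n l) = 2 := by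
  simp only [pairing, simpleRoot]
  split_ifs with h <;> simp [eps_apply]

theorem reflection_reflection (n l : ℕ) (v : Vec) :
    reflection n l (reflection n l v) = v := by
  have h : reflection n l (simpleRoot n l) = -simpleRoot n l := by
    rw [reflection, pairing_simpleRoot]; module
  rw [reflection.eq_def n l v, reflection_sub, reflection_smul, h, reflection]
  module

theorem reflection_eps_of_ne {n l j : ℕ} (hj : j ≠ fold n l) (hj' : j ≠ fold n l + 1) :
    reflection n l (eps j) = eps j := by
  have : pairing n l (eps j) = 0 := by
    simp only [pairing, eps_apply]
    unfold fold at hj hj'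
    split_ifs at * <;> omega
  rw [reflection, this, zero_smul, sub_zero]

theorem reflection_eps_self {n l : ℕ} (h : l ≠ n + 1) :
    reflection n l (eps l) = eps (l + 1) := by
  have : pairing n l (eps l) = 1 := by simp [pairing, eps_apply, h]
  rw [reflection, this, simpleRoot, if_neg h]; module

theorem reflection_eps_succ {n l : ℕ} (h : l ≠ n + 1) :
    reflection n l (eps (l + 1)) = eps l := by
  have : pairing n l (eps (l + 1)) = -1 := by simp [pairing, eps_apply, h]
  rw [reflection, this, simpleRoot, if_neg h]; module

theorem reflection_last_eps (n : ℕ) : reflection n (n + 1) (eps n) = -eps (n + 1) := by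
  have : pairing n (n + 1) (eps n) = 1 := by simp [pairing, eps_apply]
  rw [reflection, this, simpleRoot, if_pos rfl]; module

theorem reflection_last_eps_succ (n : ℕ) : reflection n (n + 1) (eps (n + 1)) = -eps n := by
  have : pairing n (n + 1) (eps (n + 1)) = 1 := by simp [pairing, eps_apply]
  rw [reflection, this, simpleRoot, if_pos rfl]; module

theorem wordAct_nil (n : ℕ) (v : Vec) : wordAct n [] v = v := rfl

theorem wordAct_cons (n l : ℕ) (w : List ℕ) (v : Vec) :
    wordAct n (l :: w) v = reflection n l (wordAct n w v) := rfl

theorem wordAct_sub (n : ℕ) (w : List ℕ) (v v' : Vec) :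
    wordAct n w (v - v') = wordAct n w v - wordAct n w v' := by
  induction w with
  | nil => rfl
  | cons l w ih => rw [wordAct_cons, ih, reflection_sub]; rfl

/-! ### Labellings of sectional paths and firing of letters -/

/-- For a height function `ξ(i) = 2 d(i) + i`, the index `m` such that the sectional paths of the
`m`-snake carry the summand `j`. -/
def snakePos (n : ℕ) (d : ℕ → ℤ) (j : ℕ) : ℤ :=
  if j = 1 then d 1 + 1 else if j = n + 1 then d n
  else if d j = d (j - 1) then d j + j else d (j - 1)

/-- `E` labels the sectional paths for the height function `2 d(i) + i` and the sign `s`. -/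
structure IsLabelling (n : ℕ) (d : ℕ → ℤ) (s : ℤ) (E : ℤ → Vec) : Prop where
  antiperiodic : Function.Antiperiodic E ((n : ℤ) + 1)
  eps : ∀ j, 1 ≤ j → j ≤ n → E (snakePos n d j) = eps j
  last : E (snakePos n d (n + 1)) = s • TwistedD.eps (n + 1)

/-- The height function after reflecting at `i`. -/
def fireHeight (d : ℕ → ℤ) (i : ℕ) : ℕ → ℤ := fun k => if k = i then d k - 1 else d k

/-- The sign after reflecting at `i`. -/
def fireSign (n : ℕ) (s : ℤ) (i : ℕ) : ℤ := if i = n then -s else s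

/-- The letter `l` can be fired: it is a sink for the height function `2 d(i) + i`, and it is the
element of its `∨`-orbit that is prescribed by `s`. -/
structure IsFireable (n : ℕ) (d : ℕ → ℤ) (s : ℤ) (l : ℕ) : Prop where
  one_le : 1 ≤ fold n l
  le : fold n l ≤ n
  left : fold n l ≠ 1 → d (fold n l - 1) = d (fold n l)
  right : fold n l ≠ n → d (fold n l + 1) = d (fold n l) - 1
  sign : l = n → s = 1
  sign' : l = n + 1 → s = -1

/-- All letters of the word can be fired one after the other. -/
def IsFireableWord (n : ℕ) : (ℕ → ℤ) → ℤ → List ℕ → Prop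
  | _, _, [] => True
  | d, s, l :: w => IsFireable n d s l ∧
      IsFireableWord n (fireHeight d (fold n l)) (fireSign n s (fold n l)) w

section fire

variable {n : ℕ} {d : ℕ → ℤ} {s : ℤ} {E : ℤ → Vec} {l : ℕ}

/-- This and the next lemmas show that firing residue `i` exchanges the positions of `i` and `i +
1`, as `s_i` exchanges `ε_i` and `ε_{i+1}`. The exception is `i = n`, where `n + 1` lands at `d n -
1`, one antiperiod below `d n + n`; this is the source of the sign change. -/
theorem IsFireable.snakePos_self (h : IsFireable n d s l) :
    snakePos n d (fold n l) = d (fold n l) + fold n l := by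
  have h1 := h.one_le
  have h2 := h.le
  unfold snakePos
  split_ifs with h3 h4 h5
  · rw [h3]; simp
  · omega
  · rfl
  · exact absurd (h.left h3).symm h5

theorem IsFireable.snakePos_succ (h : IsFireable n d s l) :
    snakePos n d (fold n l + 1) = d (fold n l) := by
  have h1 := h.one_le
  unfold snakePos
  split_ifs with h3 h4 h5
  · omega
  · exact congrArg d (by omega)
  · have := h.right (by omega)
    simp at h5; omega
  · simp

theorem IsFireable.snakePos_fire_self (h : IsFireable n d s l) :
    snakePos n (fireHeight d (fold n l)) (fold n l) = d (fold n l) := by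
  have h1 := h.one_le
  have h2 := h.le
  unfold snakePos fireHeight
  split_ifs <;> try omega
  · rename_i h3 _; rw [h3]; ring
  all_goals have := h.left ‹_›; omega

theorem IsFireable.snakePos_fire_succ (h : IsFireable n d s l) (hl : fold n l ≠ n) :
    snakePos n (fireHeight d (fold n l)) (fold n l + 1) = d (fold n l) + fold n l := by
  have h1 := h.one_le
  have h2 := h.le
  have h3 := h.right hl
  unfold snakePos fireHeight
  simp only [Nat.add_sub_cancel]
  split_ifs <;> omega

theorem IsFireable.snakePos_fire_last (h : IsFireable n d s l) (hl : fold n l = n) :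
    snakePos n (fireHeight d (fold n l)) (n + 1) = d n - 1 := by
  have h1 := h.one_le
  unfold snakePos fireHeight
  split_ifs <;> omega

theorem snakePos_fire_of_ne {i j : ℕ} (h1 : j ≠ i) (h2 : j ≠ i + 1) (hj : 1 ≤ j) :
    snakePos n (fireHeight d i) j = snakePos n d j := by
  unfold snakePos fireHeight
  split_ifs <;> omega

theorem fold_eq_self (h : l ≠ n + 1) : fold n l = l := by simp [fold, h]

theorem fold_last (n : ℕ) : fold n (n + 1) = n := by simp [fold]

/-- The two indices are the positions of `i` and `i + 1`. At the fork, `s` decides between `α_n` and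
`α_{n+1}`. -/
theorem IsLabelling.simpleRoot_eq (hE : IsLabelling n d s E) (h : IsFireable n d s l) :
    simpleRoot n l = E (d (fold n l) + fold n l) - E (d (fold n l)) := by
  have h1 := h.one_le
  have h2 := h.le
  have e1 := hE.eps _ h1 h2
  rw [h.snakePos_self] at e1
  rw [e1, ← h.snakePos_succ]
  by_cases hl : l = n + 1
  · subst hl
    rw [fold_last, hE.last, h.sign' rfl, simpleRoot, if_pos rfl]; module
  · rw [fold_eq_self hl] at *
    rw [simpleRoot, if_neg hl]
    by_cases hn : l = n
    · rw [hn, hE.last, h.sign hn, one_smul]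
    · rw [hE.eps _ (by omega) (by omega)]

theorem IsLabelling.fire (hE : IsLabelling n d s E) (h : IsFireable n d s l) :
    IsLabelling n (fireHeight d (fold n l)) (fireSign n s (fold n l))
      (fun m => reflection n l (E m)) := by
  have h1 := h.one_le
  have h2 := h.le
  have e1 := hE.eps _ h1 h2
  rw [h.snakePos_self] at e1
  refine ⟨fun m => by simp only [hE.antiperiodic m, reflection_neg], fun j hj hj' => ?_, ?_⟩
  · by_cases j1 : j = fold n l
    · subst j1
      rw [h.snakePos_fire_self, ← h.snakePos_succ]
      by_cases hl : l = n + 1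
      · subst hl
        rw [fold_last, hE.last, h.sign' rfl, reflection_smul, reflection_last_eps_succ]; module
      · rw [fold_eq_self hl] at *
        by_cases hn : l = n
        · have := h.sign hn
          subst hn
          rw [hE.last, this, one_smul, reflection_eps_succ hl]
        · rw [hE.eps _ (by omega) (by omega), reflection_eps_succ hl]
    · by_cases j2 : j = fold n l + 1
      · subst j2
        rw [h.snakePos_fire_succ (by omega), e1]
        have hl : l ≠ n + 1 := by rintro rfl; rw [fold_last] at hj'; omega
        rw [fold_eq_self hl, reflection_eps_self hl]
      · rw [snakePos_fire_of_ne j1 j2 hj, hE.eps j hj hj', reflection_eps_of_ne j1 j2]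
  · unfold fireSign
    by_cases hl : fold n l = n
    · rw [h.snakePos_fire_last hl, if_pos hl]
      -- The index `d n - 1` is one antiperiod below `d n + n`, the position of `n`.
      have e2 : E (d n - 1) = -TwistedD.eps n := by
        rw [hl] at e1
        have := hE.antiperiodic (d n - 1)
        rw [show d n - 1 + ((n : ℤ) + 1) = d n + n by ring, e1] at this
        rw [this, neg_neg]
      rw [e2, reflection_neg]
      by_cases hl' : l = n + 1
      · subst hl'
        rw [reflection_last_eps, h.sign' rfl]; module
      · rw [fold_eq_self hl'] at hl
        have := h.sign hl
        subst hl
        rw [reflection_eps_self hl', this]; module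
    · rw [if_neg hl, snakePos_fire_of_ne (by omega) (by omega) (by omega), hE.last,
        reflection_smul, reflection_eps_of_ne (by omega) (by omega)]

/-- The height function after firing a word. -/
def wordHeight (n : ℕ) (d : ℕ → ℤ) (w : List ℕ) : ℕ → ℤ := fun i => d i - (w.map (fold n)).count i

theorem wordHeight_fire (n : ℕ) (d : ℕ → ℤ) (l : ℕ) (w : List ℕ) :
    wordHeight n (fireHeight d (fold n l)) w = wordHeight n d (l :: w) := by
  funext i
  simp only [wordHeight, fireHeight, List.map_cons, List.count_cons]
  by_cases h : i = fold n l
  · subst h; simp; ring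
  · simp [h, Ne.symm h]

/-- By induction the tail produces values of `s_l ∘ E`; the outer `s_l` cancels. Only the height at
which `E` is read depends on `u`. -/
theorem IsLabelling.wordAct_simpleRoot {u v : List ℕ} (hE : IsLabelling n d s E)
    (h : IsFireableWord n d s (u ++ l :: v)) :
    wordAct n u (simpleRoot n l) =
      E (wordHeight n d u (fold n l) + fold n l) - E (wordHeight n d u (fold n l)) := by
  induction u generalizing d s E with
  | nil =>
    rw [wordAct_nil, hE.simpleRoot_eq h.1]; simp [wordHeight]
  | cons l' u ih =>
    rw [wordAct_cons, ih (hE.fire h.1) h.2, reflection_sub, reflection_reflection,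
      reflection_reflection, wordHeight_fire]

/-- The labelling `E'` is obtained by applying the letters of the word to `E` successively, that is
`w⁻¹ ∘ E`. The exponent counts the firings at the fork. -/
theorem IsLabelling.exists_wordAct {w : List ℕ} (hE : IsLabelling n d s E)
    (h : IsFireableWord n d s w) :
    ∃ E', IsLabelling n (wordHeight n d w) (s * (-1) ^ (w.map (fold n)).count n) E' ∧
      ∀ m, wordAct n w (E' m) = E m := by
  induction w generalizing d s E with
  | nil =>
    refine ⟨E, ?_, fun _ => rfl⟩
    have : wordHeight n d [] = d := by funext i; simp [wordHeight]
    simpa [this] using hE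
  | cons l w ih =>
    obtain ⟨E', h1, h2⟩ := ih (hE.fire h.1) h.2
    refine ⟨E', ?_, fun m => ?_⟩
    · rw [wordHeight_fire] at h1
      convert h1 using 1
      simp only [List.map_cons, List.count_cons, fireSign, beq_iff_eq]
      split_ifs <;> ring
    · rw [wordAct_cons, h2, reflection_reflection]

theorem isFireableWord_append (u v : List ℕ) : IsFireableWord n d s (u ++ v) ↔
    IsFireableWord n d s u ∧
      IsFireableWord n (wordHeight n d u) (s * (-1) ^ (u.map (fold n)).count n) v := by
  induction u generalizing d s with
  | nil =>
    have : wordHeight n d [] = d := by funext i; simp [wordHeight]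
    simp [IsFireableWord, this]
  | cons l u ih =>
    simp only [List.cons_append, IsFireableWord, ih, and_assoc, wordHeight_fire]
    have : fireSign n s (fold n l) * (-1) ^ (u.map (fold n)).count n =
        s * (-1) ^ ((l :: u).map (fold n)).count n := by
      simp only [List.map_cons, List.count_cons, fireSign, beq_iff_eq]
      split_ifs <;> ring
    rw [this]

/-- The height function `2 d(i) + i` is compatible with the order of the letters in `f`. -/
def IsCompatible (n : ℕ) (d : ℕ → ℤ) (f : List ℕ) : Prop :=
  ∀ k, 1 ≤ k → k < n → (f.idxOf k < f.idxOf (k + 1) → d (k + 1) = d k - 1) ∧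
    (f.idxOf (k + 1) < f.idxOf k → d (k + 1) = d k)

/-- The head precedes its neighbours, so compatibility makes it a sink. Firing it turns it into the
last letter among its neighbours, and this is the compatibility needed for the tail. -/
theorem IsCompatible.isFireableWord {w : List ℕ} (h : IsCompatible n d (w.map (fold n)))
    (hnd : (w.map (fold n)).Nodup) (hw : ∀ i ∈ w.map (fold n), 1 ≤ i ∧ i ≤ n)
    (hs : n ∈ w → s = 1) (hs' : n + 1 ∈ w → s = -1) : IsFireableWord n d s w := by
  induction w generalizing d s with
  | nil => trivial
  | cons l w ih =>
    rw [List.map_cons] at h hnd hw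
    obtain ⟨h1, h2⟩ := hw (fold n l) (by simp)
    rw [List.nodup_cons] at hnd
    refine ⟨⟨h1, h2, fun h3 => ?_, fun h3 => ?_, fun h3 => hs (by simp [h3]),
      fun h3 => hs' (by simp [h3])⟩, ih ?_ hnd.2 (fun i hi => hw i (by simp [hi])) ?_ ?_⟩
    · have := (h (fold n l - 1) (by omega) (by omega)).2
      rw [show fold n l - 1 + 1 = fold n l by omega, List.idxOf_cons_self,
        List.idxOf_cons_ne _ (by omega)] at this
      exact (this (by omega)).symm
    · have := (h (fold n l) (by omega) (by omega)).1
      rw [List.idxOf_cons_self, List.idxOf_cons_ne _ (by omega)] at this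
      exact this (by omega)
    · intro k hk hkn
      have := h k hk hkn
      simp only [fireHeight]
      by_cases h3 : k = fold n l
      · subst h3
        -- The fired residue is absent from the tail, so `idxOf` returns the length and ranks it
        -- last.
        have h4 := List.idxOf_eq_length hnd.1
        have h5 := List.idxOf_le_length (l := w.map (fold n)) (a := fold n l + 1)
        rw [List.idxOf_cons_self, List.idxOf_cons_ne _ (by omega)] at this
        refine ⟨fun h6 => by omega, fun _ => ?_⟩
        simp only [if_true, if_neg (show fold n l + 1 ≠ fold n l by omega)]
        exact this.1 (by omega)
      · by_cases h3' : k + 1 = fold n l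
        · rw [h3'] at this ⊢
          have h4 := List.idxOf_eq_length hnd.1
          have h5 := List.idxOf_le_length (l := w.map (fold n)) (a := k)
          rw [List.idxOf_cons_self, List.idxOf_cons_ne _ (by omega)] at this
          refine ⟨fun _ => ?_, fun h6 => by omega⟩
          simp only [if_true, if_neg h3]
          rw [this.2 (by omega)]
        · rw [List.idxOf_cons_ne _ (by omega), List.idxOf_cons_ne _ (by omega)] at this
          simp only [if_neg h3, if_neg h3']
          exact ⟨fun h6 => this.1 (by omega), fun h6 => this.2 (by omega)⟩
    · intro hnw
      have : fold n l ≠ n := by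
        intro h3
        refine hnd.1 (List.mem_map.mpr ⟨n, hnw, ?_⟩)
        rw [h3, fold_eq_self (by omega)]
      rw [fireSign, if_neg this]; exact hs (by simp [hnw])
    · intro hnw
      have : fold n l ≠ n := by
        intro h3
        refine hnd.1 (List.mem_map.mpr ⟨n + 1, hnw, ?_⟩)
        rw [h3, fold_last]
      rw [fireSign, if_neg this]; exact hs' (by simp [hnw])

end fire

/-! ### Snake numbers as thresholds of the height function -/

theorem exists_threshold (n : ℕ) (P : ℕ → Prop)
    (hP : ∀ i j, 1 ≤ i → i ≤ j → j ≤ n → P i → P j) :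
    ∃ j, 1 ≤ j ∧ j ≤ n + 1 ∧ ∀ i, 1 ≤ i → i ≤ n → (j ≤ i ↔ P i) := by
  classical
  -- The value `n + 1` is a sentinel for a property that never holds on `[1, n]`.
  have hex : ∃ j, 1 ≤ j ∧ (j = n + 1 ∨ P j) := ⟨n + 1, by omega, Or.inl rfl⟩
  have hsp := Nat.find_spec hex
  have hle : Nat.find hex ≤ n + 1 := Nat.find_min' hex ⟨by omega, Or.inl rfl⟩
  refine ⟨Nat.find hex, hsp.1, hle, fun i hi hin => ⟨fun h => ?_, fun h => ?_⟩⟩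
  · exact hP _ _ hsp.1 h hin (hsp.2.resolve_left (by omega))
  · exact Nat.find_min' hex ⟨hi, Or.inr h⟩

/-- `ξ(i) = 2 d(i) + i` is the normalised height function of a quiver of type `A_n`. -/
structure IsShapeHeight (n : ℕ) (d : ℕ → ℤ) : Prop where
  step : ∀ k, 1 ≤ k → k < n → d (k + 1) = d k ∨ d (k + 1) = d k - 1
  last : d n = 0

/-- These monotonicities make `r ≤ d i + i` and `d i < r` upward closed in `i`, so that thresholds
exist. -/
theorem IsShapeHeight.bounds {n : ℕ} {d : ℕ → ℤ} (hd : IsShapeHeight n d) {i j : ℕ} (hi : 1 ≤ i)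
    (hij : i ≤ j) (hj : j ≤ n) : d j ≤ d i ∧ d i + i ≤ d j + j := by
  induction j, hij using Nat.le_induction with
  | base => simp
  | succ k hk ih =>
    have := ih (by omega)
    rcases hd.step k (by omega) (by omega) with h | h <;> push_cast <;> omega

/-- `e(r)` is the number of the `r`-snake, for `0 ≤ r ≤ n`. -/
structure IsSnakeIndex (n : ℕ) (d : ℕ → ℤ) (e : ℤ → ℕ) : Prop where
  one_le : ∀ r : ℤ, 0 ≤ r → r ≤ n → 1 ≤ e r
  le : ∀ r : ℤ, 0 ≤ r → r ≤ n → e r ≤ n + 1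
  high : ∀ r, d 1 < r → r ≤ n → ∀ i, 1 ≤ i → i ≤ n → (e r ≤ i ↔ r ≤ d i + i)
  low : ∀ r, 0 ≤ r → r ≤ d 1 → ∀ i, 1 ≤ i → i ≤ n → (e r ≤ i ↔ d i < r)

theorem IsShapeHeight.exists_snakeIndex {n : ℕ} {d : ℕ → ℤ} (hd : IsShapeHeight n d) :
    ∃ e, IsSnakeIndex n d e := by
  have h1 := fun r : ℤ => exists_threshold n (fun i => r ≤ d i + i) fun i j hi hij hj h => by
    have := hd.bounds hi hij hj; omega
  have h2 := fun r : ℤ => exists_threshold n (fun i => d i < r) fun i j hi hij hj h => by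
    have := hd.bounds hi hij hj; omega
  choose e1 h1 using h1
  choose e2 h2 using h2
  refine ⟨fun r => if d 1 < r then e1 r else e2 r, fun r _ _ => ?_, fun r _ _ => ?_,
    fun r hr _ i hi hin => ?_, fun r _ hr i hi hin => ?_⟩
  · split_ifs
    exacts [(h1 r).1, (h2 r).1]
  · split_ifs
    exacts [(h1 r).2.1, (h2 r).2.1]
  · rw [if_pos hr]; exact (h1 r).2.2 i hi hin
  · rw [if_neg (by omega)]; exact (h2 r).2.2 i hi hin

/-- The value `d 1` separates the top S-index from the top N-index for every residue at once; hence
the case split at `d 1` below. -/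
theorem IsShapeHeight.mem_range {n : ℕ} {d : ℕ → ℤ} (hd : IsShapeHeight n d) {i : ℕ} (hi : 1 ≤ i) (hin : i ≤ n) :
    0 ≤ d i ∧ d i ≤ d 1 ∧ d 1 < d i + i ∧ d i + i ≤ n := by
  have h1 := hd.bounds le_rfl hi hin
  have h2 := hd.bounds hi hin le_rfl
  have := hd.last; push_cast at *; omega

section index

variable {n : ℕ} {d : ℕ → ℤ} {e : ℤ → ℕ} (hn : 1 ≤ n) (hd : IsShapeHeight n d)
  (he : IsSnakeIndex n d e)

include hn hd

theorem IsShapeHeight.nonneg : 0 ≤ d 1 := by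
  have := hd.bounds le_rfl hn le_rfl; have := hd.last; omega

theorem IsShapeHeight.lt : d 1 < n := by
  have := hd.bounds le_rfl hn le_rfl; have := hd.last; push_cast at *; omega

theorem IsShapeHeight.snakePos_mem {j : ℕ} (hj : 1 ≤ j) (hjn : j ≤ n + 1) :
    0 ≤ snakePos n d j ∧ snakePos n d j ≤ n := by
  have h1 := hd.mem_range le_rfl hn
  have h0 := hd.last
  unfold snakePos
  split_ifs with h2 h3 h4
  · push_cast at *; omega
  · omega
  · have := hd.mem_range hj (by omega); omega
  · have := hd.mem_range (i := j - 1) (by omega) (by omega); omega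

include he

/-- Both `d i + i` and `-d i` grow by steps of 0 or 1. For `r > d 1` the first sequence therefore
hits `r` exactly at the threshold, where `d` is constant; for `r ≤ d 1` the value of `d` just before
the threshold is `r`. -/
theorem IsSnakeIndex.snakePos_eq {r : ℤ} (hr : 0 ≤ r) (hrn : r ≤ n) :
    snakePos n d (e r) = r := by
  have h1 := he.one_le r hr hrn
  have h2 := he.le r hr hrn
  have h0 := hd.last
  have h00 := hd.mem_range le_rfl hn
  rcases lt_or_ge (d 1) r with h | h
  · have hh := he.high r h hrn
    have h3 : e r ≤ n := (hh n hn le_rfl).mpr (by omega)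
    have h4 := (hh (e r) h1 h3).mp le_rfl
    by_cases h5 : e r = 1
    · rw [h5] at h4 ⊢
      rw [snakePos, if_pos rfl]; push_cast at h4; omega
    · have h6 := hh (e r - 1) (by omega) (by omega)
      have h7 := hd.step (e r - 1) (by omega) (by omega)
      rw [show e r - 1 + 1 = e r by omega] at h7
      have h8 : ¬ (r ≤ d (e r - 1) + ((e r - 1 : ℕ) : ℤ)) := fun h8 => by
        have := h6.mpr h8; omega
      push_cast [h1] at h8
      unfold snakePos
      rw [if_neg h5, if_neg (by omega), if_pos (by omega)]
      omega
  · have hh := he.low r hr h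
    have h3 : 2 ≤ e r := by
      by_contra h3
      have := (hh 1 le_rfl hn).mp (by omega); omega
    have h6 := hh (e r - 1) (by omega) (by omega)
    have h8 : r ≤ d (e r - 1) := by
      by_contra h8
      have := h6.mpr (by omega); omega
    unfold snakePos
    rw [if_neg (by omega)]
    split_ifs with h4 h5
    · rw [show e r - 1 = n by omega] at h8; omega
    · have := (hh (e r) h1 (by omega)).mp le_rfl; omega
    · have := (hh (e r) h1 (by omega)).mp le_rfl
      have h7 := hd.step (e r - 1) (by omega) (by omega)
      rw [show e r - 1 + 1 = e r by omega] at h7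
      omega

theorem IsSnakeIndex.apply_snakePos {j : ℕ} (hj : 1 ≤ j) (hjn : j ≤ n + 1) :
    e (snakePos n d j) = j := by
  have hm := hd.snakePos_mem hn hj hjn
  have h1 := he.one_le _ hm.1 hm.2
  have h2 := he.le _ hm.1 hm.2
  have h0 := hd.last
  have h00 := hd.mem_range le_rfl hn
  -- Two numbers in `[1, n + 1]` that compare alike with every `i` in `[1, n]` are equal.
  have key : ∀ i, 1 ≤ i → i ≤ n → (e (snakePos n d j) ≤ i ↔ j ≤ i) := by
    intro i hi hin
    have h3 : snakePos n d j = snakePos n d j := rfl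
    conv_rhs at h3 => unfold snakePos
    split_ifs at h3 with h4 h5 h6
    · rw [he.high _ (by omega) hm.2 i hi hin, h3]
      have := hd.mem_range hi hin
      omega
    · rw [he.low _ (by omega) (by omega) i hi hin, h3]
      have := hd.mem_range hi hin
      omega
    · have h7 := hd.mem_range hj (by omega)
      rw [he.high _ (by omega) hm.2 i hi hin, h3]
      refine ⟨fun h => ?_, fun h => (hd.bounds hj h hin).2⟩
      by_contra h8
      have := (hd.bounds hi (show i ≤ j - 1 by omega) (by omega)).2
      push_cast [hj] at this
      omega
    · have h7 := hd.mem_range (i := j - 1) (by omega) (by omega)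
      rw [he.low _ (by omega) (by omega) i hi hin, h3]
      have h8 := hd.step (j - 1) (by omega) (by omega)
      rw [show j - 1 + 1 = j by omega] at h8
      refine ⟨fun h => ?_, fun h => ?_⟩
      · by_contra h9
        have := (hd.bounds hi (show i ≤ j - 1 by omega) (by omega)).1
        omega
      · have := (hd.bounds hj h hin).1
        omega
  have a := key (e (snakePos n d j)) h1
  have b := key j hj
  omega

theorem IsSnakeIndex.injective {r r' : ℤ} (hr : 0 ≤ r) (hrn : r ≤ n) (hr' : 0 ≤ r')
    (hrn' : r' ≤ n) (h : e r = e r') : r = r' := by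
  rw [← he.snakePos_eq hn hd hr hrn, h, he.snakePos_eq hn hd hr' hrn']

theorem IsSnakeIndex.zero : e 0 = n + 1 := by
  have := he.apply_snakePos hn hd (j := n + 1) (by omega) le_rfl
  rwa [snakePos, if_neg (by omega), if_pos rfl, hd.last] at this

/-- The condition `d i < r` weakens as `r` grows, so its threshold moves down. The opposite
behaviour above `d 1` is the next lemma; both orderings decide which summand of a root comes first.
-/
theorem IsSnakeIndex.lt_of_low {r r' : ℤ} (hr : 0 ≤ r) (hrr : r < r') (hr' : r' ≤ d 1) :
    e r' < e r := by
  have h0 := hd.lt hn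
  have h1 := he.one_le r' (by omega) (by omega)
  have h2 := he.le r' (by omega) (by omega)
  have h3 : e r ≠ e r' := fun h => by
    have := he.injective hn hd hr (by omega) (by omega) (by omega) h; omega
  by_contra h4
  have h5 := he.one_le r (by omega) (by omega)
  have h6 := (he.low r hr (by omega) (e r) h5 (by omega)).mp le_rfl
  have h7 := he.low r' (by omega) hr' (e r) h5 (by omega)
  omega

theorem IsSnakeIndex.lt_of_high {r r' : ℤ} (hr : d 1 < r) (hrr : r < r') (hr' : r' ≤ n) :
    e r < e r' := by
  have h0 := hd.nonneg hn
  have h1 := he.one_le r' (by omega) (by omega)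
  have h2 := he.le r (by omega) (by omega)
  have h3 : e r ≠ e r' := fun h => by
    have := he.injective hn hd (by omega) (by omega) (by omega) (by omega) h; omega
  by_contra h4
  have h6 := (he.high r' (by omega) hr' (e r') h1 (by omega)).mp le_rfl
  have h7 := he.high r (by omega) (by omega) (e r') h1 (by omega)
  omega

/-- `E` is prescribed on the window `[0, n]` by `e` and extended antiperiodically. Only the residue
0, where `e` is `n + 1`, sees the sign `s`. -/
theorem IsSnakeIndex.exists_labelling (s : ℤ) : ∃ E, IsLabelling n d s E := by
  let N : ℤ := n + 1
  have hN : N ≠ 0 := by simp only [N]; omega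
  let E : ℤ → Vec := fun m => ((if Even (m / N) then 1 else -1) * (if m % N = 0 then s else 1) : ℤ)
    • eps (e (m % N))
  have hE : ∀ r : ℤ, 0 ≤ r → r ≤ n → E r = (if r = 0 then s else 1 : ℤ) • eps (e r) := by
    intro r h0 h1
    have h2 : r / N = 0 := Int.ediv_eq_zero_of_lt h0 (by simp only [N]; omega)
    have h3 : r % N = r := Int.emod_eq_of_lt h0 (by simp only [N]; omega)
    simp only [E, h2, h3]; simp
  have hpos : ∀ j, 1 ≤ j → j ≤ n → snakePos n d j ≠ 0 := by
    intro j hj hjn h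
    have h1 := he.apply_snakePos hn hd hj (by omega)
    rw [h, he.zero hn hd] at h1; omega
  refine ⟨E, fun m => ?_, fun j hj hjn => ?_, ?_⟩
  · simp only [E]
    rw [show m + ((n : ℤ) + 1) = m + N from rfl, Int.add_emod_right, Int.add_ediv_of_dvd_right
      (dvd_refl N), Int.ediv_self hN]
    simp only [Int.even_add_one]
    split_ifs <;> first | contradiction | module
  · have hm := hd.snakePos_mem hn hj (by omega)
    rw [hE _ hm.1 hm.2, if_neg (hpos j hj hjn), he.apply_snakePos hn hd hj (by omega), one_smul]
  · have hm := hd.snakePos_mem hn (j := n + 1) (by omega) le_rfl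
    have h0 : snakePos n d (n + 1) = 0 := by
      rw [snakePos, if_neg (by omega), if_pos rfl, hd.last]
    rw [h0, hE 0 le_rfl (by omega), if_pos rfl, he.zero hn hd]

end index

/-! ### Positive roots and their summands -/

theorem signedEps_natCast (y : ℕ) (hy : 1 ≤ y) : signedEps (y : ℤ) = eps y := by
  rw [signedEps, Int.sign_eq_one_of_pos (by omega), one_smul, Int.natAbs_natCast]

theorem signedEps_neg_natCast (y : ℕ) (hy : 1 ≤ y) : signedEps (-(y : ℤ)) = -eps y := by
  rw [signedEps, Int.sign_eq_neg_one_of_neg (by omega), neg_one_smul, Int.natAbs_neg,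
    Int.natAbs_natCast]

theorem isPosRoot_add {n x y : ℕ} {σ : ℤ} (hσ : σ = 1 ∨ σ = -1) (hx : 1 ≤ x) (hxy : x < y)
    (hy : y ≤ n + 1) : IsPosRoot n (eps x + σ • eps y) := by
  refine ⟨x, σ * y, ⟨hx, ?_, ?_⟩, ?_⟩
  · rcases hσ with rfl | rfl <;> omega
  · rcases hσ with rfl | rfl <;> omega
  · rcases hσ with rfl | rfl
    · rw [bracket, one_mul, signedEps_natCast _ (by omega), one_smul]
    · rw [bracket, neg_one_mul, signedEps_neg_natCast _ (by omega), neg_one_smul]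

theorem IsPosRoot.exists_eps {n : ℕ} {β : Vec} (h : IsPosRoot n β) :
    ∃ (x y : ℕ) (σ : ℤ), (σ = 1 ∨ σ = -1) ∧ 1 ≤ x ∧ x < y ∧ y ≤ n + 1 ∧
      β = eps x + σ • eps y := by
  obtain ⟨a, b, ⟨h1, h2, h3⟩, rfl⟩ := h
  refine ⟨a, b.natAbs, b.sign, ?_, h1, h2, h3, rfl⟩
  rcases lt_trichotomy b 0 with hb | hb | hb
  · exact Or.inr (Int.sign_eq_neg_one_of_neg hb)
  · subst hb; simp at h2
  · exact Or.inl (Int.sign_eq_one_of_pos hb)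

/-- The nonzero coefficient of lowest index of a positive root is 1. Combined with antiperiodicity,
this confines the positive roots to `0 ≤ t ≤ n`. -/
theorem IsPosRoot.neg_not {n : ℕ} {β : Vec} (h : IsPosRoot n β) : ¬ IsPosRoot n (-β) := by
  intro h'
  obtain ⟨x, y, σ, hσ, hx, hxy, hy, rfl⟩ := h.exists_eps
  obtain ⟨x', y', σ', hσ', hx', hxy', hy', he⟩ := h'.exists_eps
  have h1 := congrFun he x
  have h2 := congrFun he x'
  simp only [Pi.neg_apply, Pi.add_apply, Pi.smul_apply, eps_apply, smul_eq_mul] at h1 h2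
  rcases hσ with rfl | rfl <;> rcases hσ' with rfl | rfl <;> split_ifs at * <;> omega

/-- Replaces summands by a coordinate test. No cancellation occurs, since the two summands differ in
absolute value. -/
theorem IsPosRoot.isSummand_iff {n : ℕ} {β : Vec} (h : IsPosRoot n β) {p : ℕ} (hp : 1 ≤ p) :
    (IsSummand n β p ∨ IsSummand n β (-(p : ℤ))) ↔ β p ≠ 0 := by
  constructor
  · have key : ∀ p' : ℤ, p'.natAbs = p → IsSummand n β p' → β p ≠ 0 := by
      rintro p' rfl ⟨a, b, ⟨h1, h2, h3⟩, rfl, hab⟩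
      have hb : b.sign ≠ 0 := by
        rw [Ne, Int.sign_eq_zero_iff_zero]; rintro rfl; simp at h2
      simp only [bracket, signedEps, Pi.add_apply, Pi.smul_apply, eps_apply, smul_eq_mul]
      rcases hab with rfl | rfl
      · rw [if_pos (by omega), if_neg (by omega)]; simp
      · rw [if_neg (by omega), if_pos rfl]; simpa using hb
    rintro (h | h)
    · exact key _ (by omega) h
    · exact key _ (by omega) h
  · obtain ⟨a, b, hab, rfl⟩ := h
    intro h0
    have : p = a ∨ p = b.natAbs := by
      by_contra hc
      push Not at hc
      apply h0
      simp [bracket, signedEps, eps_apply, hc.1, hc.2]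
    rcases this with rfl | hpb
    · exact Or.inl ⟨p, b, hab, rfl, Or.inl rfl⟩
    · rcases le_total 0 b with hb | hb
      · exact Or.inl ⟨a, b, hab, rfl, Or.inr (by omega)⟩
      · exact Or.inr ⟨a, b, hab, rfl, Or.inr (by omega)⟩

/-! ### The bijection between vertices and positive roots -/

/-- A height function with its snake numbers and the labelling of its sectional paths. -/
structure SnakeData (n : ℕ) (d : ℕ → ℤ) (s : ℤ) (E : ℤ → Vec) (e : ℤ → ℕ) : Prop where
  two_le : 2 ≤ n
  height : IsShapeHeight n d
  index : IsSnakeIndex n d e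
  labelling : IsLabelling n d s E
  sign : s = 1 ∨ s = -1

namespace SnakeData

variable {n : ℕ} {d : ℕ → ℤ} {s : ℤ} {E : ℤ → Vec} {e : ℤ → ℕ}

theorem one_le (D : SnakeData n d s E e) : 1 ≤ n := by have := D.two_le; omega

theorem add_period (D : SnakeData n d s E e) (m : ℤ) : E (m + ((n : ℤ) + 1)) = -E m :=
  D.labelling.antiperiodic m

theorem eq_of_dvd (D : SnakeData n d s E e) {m k : ℤ} (h : 2 * ((n : ℤ) + 1) ∣ m - k) :
    E m = E k := by
  obtain ⟨q, hq⟩ := h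
  have := (D.labelling.antiperiodic.periodic_two_mul).int_mul q k
  rw [← this]
  congr 1
  push_cast
  linarith

theorem eq_or_neg_of_dvd (D : SnakeData n d s E e) {m k : ℤ} (h : ((n : ℤ) + 1) ∣ m - k) :
    E m = E k ∨ E m = -E k := by
  obtain ⟨q, hq⟩ := h
  rcases Int.even_or_odd' q with ⟨x, rfl | rfl⟩
  · exact Or.inl (D.eq_of_dvd ⟨x, by rw [hq]; ring⟩)
  · right
    rw [← D.add_period]
    exact D.eq_of_dvd ⟨x, by linear_combination hq⟩

theorem apply_of_mem (D : SnakeData n d s E e) {r : ℤ} (h0 : 0 ≤ r) (hr : r ≤ n) :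
    E r = (if r = 0 then s else 1 : ℤ) • eps (e r) := by
  have hz := D.index.zero D.one_le D.height
  have hp := D.index.snakePos_eq D.one_le D.height h0 hr
  have hE := D.labelling.eps (e r) (D.index.one_le r h0 hr)
  have hl := D.labelling.last
  have hle := D.index.le r h0 hr
  split_ifs with h
  · subst h
    rw [hz] at hp ⊢
    rw [← hl, hp]
  · have : e r ≠ n + 1 := fun h' =>
      h (D.index.injective D.one_le D.height h0 hr le_rfl (by omega) (h'.trans hz.symm))
    rw [hp] at hE
    rw [hE (by omega), one_smul]

theorem emod_mem (_ : SnakeData n d s E e) (m : ℤ) :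
    0 ≤ m % ((n : ℤ) + 1) ∧ m % ((n : ℤ) + 1) ≤ n :=
  ⟨Int.emod_nonneg _ (by omega), by have := Int.emod_lt_of_pos m (b := (n : ℤ) + 1) (by omega); omega⟩

theorem exists_sign (D : SnakeData n d s E e) (m : ℤ) :
    ∃ σ : ℤ, (σ = 1 ∨ σ = -1) ∧ E m = σ • eps (e (m % ((n : ℤ) + 1))) := by
  have hm := D.emod_mem m
  have h1 := D.apply_of_mem hm.1 hm.2
  have hdvd : ((n : ℤ) + 1) ∣ m - m % ((n : ℤ) + 1) := Int.dvd_self_sub_emod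
  have hs : ∃ τ : ℤ, (τ = 1 ∨ τ = -1) ∧
      E (m % ((n : ℤ) + 1)) = τ • eps (e (m % ((n : ℤ) + 1))) := by
    refine ⟨_, ?_, h1⟩
    split_ifs
    exacts [D.sign, Or.inl rfl]
  obtain ⟨τ, hτ, h2⟩ := hs
  rcases D.eq_or_neg_of_dvd hdvd with h | h
  · exact ⟨τ, hτ, h.trans h2⟩
  · refine ⟨-τ, by omega, ?_⟩
    rw [h, h2]; module

theorem index_eq_iff (D : SnakeData n d s E e) {m k : ℤ} :
    e (m % ((n : ℤ) + 1)) = e (k % ((n : ℤ) + 1)) ↔ ((n : ℤ) + 1) ∣ m - k := by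
  have hm := D.emod_mem m
  have hk := D.emod_mem k
  rw [← Int.emod_emod_of_dvd m (dvd_refl ((n : ℤ) + 1))]
  constructor
  · intro h
    rw [Int.emod_emod_of_dvd _ dvd_rfl] at h
    exact (Int.emod_eq_emod_iff_emod_sub_eq_zero.mp
      (D.index.injective D.one_le D.height hm.1 hm.2 hk.1 hk.2 h)) |> Int.dvd_of_emod_eq_zero
  · intro h
    rw [Int.emod_emod_of_dvd _ dvd_rfl]
    exact congrArg e (Int.emod_eq_emod_iff_emod_sub_eq_zero.mpr (Int.emod_eq_zero_of_dvd h))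

theorem dvd_of_eq (D : SnakeData n d s E e) {m k : ℤ} (h : E m = E k) :
    2 * ((n : ℤ) + 1) ∣ m - k := by
  obtain ⟨σ, hσ, h1⟩ := D.exists_sign m
  obtain ⟨τ, hτ, h2⟩ := D.exists_sign k
  have hne : ¬ E k = -E k := by
    intro h3
    have := congrFun h3 (e (k % ((n : ℤ) + 1)))
    rw [h2] at this
    simp [eps_apply] at this
    omega
  have hidx : e (m % ((n : ℤ) + 1)) = e (k % ((n : ℤ) + 1)) := by
    have := congrFun h (e (m % ((n : ℤ) + 1)))
    rw [h1, h2] at this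
    by_contra hc
    simp [eps_apply, hc] at this
    omega
  obtain ⟨q, hq⟩ := D.index_eq_iff.mp hidx
  rcases Int.even_or_odd' q with ⟨x, rfl | rfl⟩
  · exact ⟨x, by rw [hq]; ring⟩
  · exfalso
    apply hne
    rw [← D.add_period, ← h]
    exact D.eq_of_dvd ⟨x, by linear_combination hq⟩

theorem dvd_of_eq_neg (D : SnakeData n d s E e) {m k : ℤ} (h : E m = -E k) :
    2 * ((n : ℤ) + 1) ∣ m - (k + ((n : ℤ) + 1)) :=
  D.dvd_of_eq (h.trans (D.add_period k).symm)

/-- Each side is a sum of two signed basis vectors with different indices, so it determines the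
unordered pair of its terms. -/
theorem sub_eq_sub (D : SnakeData n d s E e) {m m' k k' : ℤ} (h : E m - E m' = E k - E k')
    (hm : ¬ ((n : ℤ) + 1) ∣ m - m') (hk : ¬ ((n : ℤ) + 1) ∣ k - k') :
    (E m = E k ∧ E m' = E k') ∨ (E m = -E k' ∧ E m' = -E k) := by
  obtain ⟨σ, hσ, h1⟩ := D.exists_sign m
  obtain ⟨σ', hσ', h2⟩ := D.exists_sign m'
  obtain ⟨τ, hτ, h3⟩ := D.exists_sign k
  obtain ⟨τ', hτ', h4⟩ := D.exists_sign k'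
  rw [← D.index_eq_iff] at hm hk
  rw [h1, h2, h3, h4] at h ⊢
  generalize e (m % ((n : ℤ) + 1)) = x at *
  generalize e (m' % ((n : ℤ) + 1)) = x' at *
  generalize e (k % ((n : ℤ) + 1)) = y at *
  generalize e (k' % ((n : ℤ) + 1)) = y' at *
  have e1 := congrFun h x
  have e2 := congrFun h x'
  simp only [Pi.sub_apply, Pi.smul_apply, eps_apply, smul_eq_mul, if_true, if_neg hm,
    if_neg (Ne.symm hm), mul_one, mul_zero] at e1 e2
  by_cases c1 : x = y
  · subst c1
    rw [if_pos rfl, if_neg hk] at e1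
    rw [if_neg (Ne.symm hm)] at e2
    left
    by_cases c2 : x' = y'
    · subst c2
      rw [if_pos rfl] at e2
      rw [show σ = τ by omega, show σ' = τ' by omega]; exact ⟨rfl, rfl⟩
    · rw [if_neg c2] at e2; omega
  · rw [if_neg c1] at e1
    by_cases c2 : x = y'
    · subst c2
      rw [if_pos rfl] at e1
      rw [if_neg (Ne.symm hm)] at e2
      right
      by_cases c3 : x' = y
      · subst c3
        rw [if_pos rfl] at e2
        rw [show σ = -τ' by omega, show σ' = -τ by omega]
        exact ⟨neg_smul _ _, neg_smul _ _⟩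
      · rw [if_neg c3] at e2; omega
    · rw [if_neg c2] at e1; omega

theorem sub_apply_ne_zero_iff (D : SnakeData n d s E e) {m m' : ℤ}
    (hm : ¬ ((n : ℤ) + 1) ∣ m - m') (p : ℕ) :
    (E m - E m') p ≠ 0 ↔ p = e (m % ((n : ℤ) + 1)) ∨ p = e (m' % ((n : ℤ) + 1)) := by
  obtain ⟨σ, hσ, h1⟩ := D.exists_sign m
  obtain ⟨σ', hσ', h2⟩ := D.exists_sign m'
  rw [← D.index_eq_iff] at hm
  rw [h1, h2]
  simp only [Pi.sub_apply, Pi.smul_apply, eps_apply, smul_eq_mul]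
  split_ifs <;> omega

theorem not_dvd {i : ℕ} (hi : 1 ≤ i) (hin : i ≤ n) (x : ℤ) :
    ¬ ((n : ℤ) + 1) ∣ (x + i) - x := by
  rw [add_sub_cancel_left]
  intro h
  have := Int.le_of_dvd (by omega) h
  omega

/-- The root at the vertex `(i, 2 d(i) + i - 2 t)`. -/
def root (d : ℕ → ℤ) (E : ℤ → Vec) (i : ℕ) (t : ℤ) : Vec := E (d i - t + i) - E (d i - t)

theorem root_add_period (D : SnakeData n d s E e) (i : ℕ) (t : ℤ) :
    root d E i (t + ((n : ℤ) + 1)) = -root d E i t := by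
  unfold root
  have h1 := D.add_period (d i - (t + ((n : ℤ) + 1)) + i)
  have h2 := D.add_period (d i - (t + ((n : ℤ) + 1)))
  rw [show d i - (t + ((n : ℤ) + 1)) + i + ((n : ℤ) + 1) = d i - t + i by ring] at h1
  rw [show d i - (t + ((n : ℤ) + 1)) + ((n : ℤ) + 1) = d i - t by ring] at h2
  rw [h1, h2]; module

/-- Put `x = d i - t`. Both `x` and `x + i` lie within one antiperiod of `[0, n]`, and a negative
index costs a sign. If `x < 0 ≤ x + i`, the root is a sum of two vectors. Otherwise it is a
difference, and its order follows from monotonicity of `e` when the two residues lie on the same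
side of `d 1`, or from both thresholds being compared with `i` when they do not. -/
theorem isPosRoot_root (D : SnakeData n d s E e) {i : ℕ} {t : ℤ} (hi : 1 ≤ i) (hin : i ≤ n)
    (ht : 0 ≤ t) (htn : t ≤ n) : IsPosRoot n (root d E i t) := by
  have hr := D.height.mem_range hi hin
  have hn := D.one_le
  have h1 := D.height.lt hn
  unfold root
  rcases le_or_gt 0 (d i - t) with hc | hc
  · rw [D.apply_of_mem hc (by omega), D.apply_of_mem (r := d i - t + i) (by omega) (by omega),
      if_neg (show d i - t + i ≠ 0 by omega), one_smul, sub_eq_add_neg, ← neg_smul]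
    refine isPosRoot_add ?_ (D.index.one_le _ (by omega) (by omega)) ?_
      (D.index.le _ hc (by omega))
    · have := D.sign; split_ifs <;> omega
    · rcases lt_or_ge (d 1) (d i - t + i) with h | h
      · have a := (D.index.high _ h (by omega) i hi hin).mpr (by omega)
        have b := D.index.low _ hc (by omega) i hi hin
        omega
      · exact D.index.lt_of_low hn D.height hc (by omega) h
  · have hm' : E (d i - t) = -eps (e (d i - t + ((n : ℤ) + 1))) := by
      have := D.add_period (d i - t)
      rw [← neg_eq_iff_eq_neg, ← this, D.apply_of_mem (by omega) (by omega), if_neg (by omega),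
        one_smul]
    rcases le_or_gt 0 (d i - t + i) with hc2 | hc2
    · rw [hm', D.apply_of_mem hc2 (by omega), sub_neg_eq_add]
      have hz := D.index.zero hn D.height
      have hne : e (d i - t + i) ≠ e (d i - t + ((n : ℤ) + 1)) := fun h => by
        have := D.index.injective hn D.height hc2 (by omega) (by omega) (by omega) h
        omega
      have l1 := D.index.le (d i - t + i) (by omega) (by omega)
      have l2 := D.index.le (d i - t + ((n : ℤ) + 1)) (by omega) (by omega)
      have l3 := D.index.one_le (d i - t + i) (by omega) (by omega)
      have l4 := D.index.one_le (d i - t + ((n : ℤ) + 1)) (by omega) (by omega)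
      -- Residue 0 carries `s • ε_{n+1}`, which has to be the second summand whatever its sign.
      by_cases h0 : d i - t + i = 0
      · rw [h0] at hne l1 l3 ⊢
        rw [if_pos rfl, add_comm]
        exact isPosRoot_add D.sign l4 (by omega) l1
      · rw [if_neg h0, one_smul]
        rcases lt_or_gt_of_ne hne with hlt | hlt
        · simpa using isPosRoot_add (σ := 1) (Or.inl rfl) l3 hlt l2
        · rw [add_comm]
          simpa using isPosRoot_add (σ := 1) (Or.inl rfl) l4 hlt l1
    · have hm : E (d i - t + i) = -eps (e (d i - t + i + ((n : ℤ) + 1))) := by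
        have := D.add_period (d i - t + i)
        rw [← neg_eq_iff_eq_neg, ← this, D.apply_of_mem (by omega) (by omega), if_neg (by omega),
          one_smul]
      rw [hm, hm', show -eps (e (d i - t + i + ((n : ℤ) + 1))) -
        -eps (e (d i - t + ((n : ℤ) + 1))) = eps (e (d i - t + ((n : ℤ) + 1))) +
          (-1 : ℤ) • eps (e (d i - t + i + ((n : ℤ) + 1))) by module]
      refine isPosRoot_add (Or.inr rfl) (D.index.one_le _ (by omega) (by omega)) ?_
        (D.index.le _ (by omega) (by omega))
      have a := D.index.high (d i - t + i + ((n : ℤ) + 1)) (by omega) (by omega) i hi hin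
      rcases lt_or_ge (d 1) (d i - t + ((n : ℤ) + 1)) with h | h
      · exact D.index.lt_of_high hn D.height h (by omega) (by omega)
      · have b := (D.index.low _ (by omega) h i hi hin).mpr (by omega)
        omega

/-- Matching terms in order gives congruences modulo `2 (n + 1)` inside a window where they are
equalities. Matching them crosswise would force `2 (n + 1) ∣ i + j`, although `0 < i + j ≤ 2 n`. -/
theorem root_injective (D : SnakeData n d s E e) {i j : ℕ} {t u : ℤ} (hi : 1 ≤ i) (hin : i ≤ n)
    (hj : 1 ≤ j) (hjn : j ≤ n) (ht : 0 ≤ t) (htn : t ≤ n) (hu : 0 ≤ u) (hun : u ≤ n)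
    (h : root d E i t = root d E j u) : i = j ∧ t = u := by
  rcases D.sub_eq_sub h (not_dvd hi hin _) (not_dvd hj hjn _) with ⟨h1, h2⟩ | ⟨h1, h2⟩
  · have h1 := D.dvd_of_eq h1
    have h2 := D.dvd_of_eq h2
    have h3 := dvd_sub h1 h2
    rw [show d i - t + i - (d j - u + j) - (d i - t - (d j - u)) = (i : ℤ) - j by ring] at h3
    have hij : i = j := by
      have := Int.eq_zero_of_abs_lt_dvd h3 (by rw [abs_lt]; omega)
      omega
    subst hij
    refine ⟨rfl, ?_⟩
    rw [show d i - t - (d i - u) = u - t by ring] at h2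
    have := Int.eq_zero_of_abs_lt_dvd h2 (by rw [abs_lt]; omega)
    omega
  · have h1 := D.dvd_of_eq_neg h1
    have h2 := D.dvd_of_eq_neg h2
    have h3 := dvd_sub h1 h2
    rw [show d i - t + i - (d j - u + ((n : ℤ) + 1)) - (d i - t - (d j - u + j + ((n : ℤ) + 1))) =
      (i : ℤ) + j by ring] at h3
    have := Int.le_of_dvd (by omega) h3
    omega

theorem exists_eq_smul_eps (D : SnakeData n d s E e) {j : ℕ} (hj : 1 ≤ j) (hjn : j ≤ n + 1)
    {σ : ℤ} (hσ : σ = 1 ∨ σ = -1) : ∃ m, E m = σ • eps j := by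
  have hm := D.height.snakePos_mem D.one_le hj hjn
  have h1 := D.apply_of_mem hm.1 hm.2
  rw [D.index.apply_snakePos D.one_le D.height hj hjn] at h1
  have hs : (if snakePos n d j = 0 then s else 1 : ℤ) = 1 ∨
      (if snakePos n d j = 0 then s else 1 : ℤ) = -1 := by
    have := D.sign; split_ifs <;> omega
  generalize (if snakePos n d j = 0 then s else 1 : ℤ) = τ at *
  by_cases h : τ = σ
  · exact ⟨_, h ▸ h1⟩
  · refine ⟨_, (D.add_period (snakePos n d j)).trans ?_⟩
    rw [h1, show τ = -σ by omega, neg_smul, neg_neg]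

/-- The difference of the indices is the residue `i`, and `t` is `d i - m'` reduced modulo `2 (n +
1)`. If `t > n`, the negative of the root would be positive as well. -/
theorem exists_root_of_sub (D : SnakeData n d s E e) {m m' : ℤ} (h1 : 1 ≤ m - m')
    (h2 : m - m' ≤ n) (hβ : IsPosRoot n (E m - E m')) : ∃ (i : ℕ) (t : ℤ), 1 ≤ i ∧ i ≤ n ∧
      0 ≤ t ∧ t ≤ n ∧ E m - E m' = root d E i t := by
  obtain ⟨i, hi⟩ := Int.eq_ofNat_of_zero_le (show 0 ≤ m - m' by omega)
  have hi : m = m' + i := by omega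
  subst hi
  have hr : E (m' + i) - E m' = root d E i ((d i - m') % (2 * ((n : ℤ) + 1))) := by
    obtain ⟨q, hq⟩ := Int.dvd_self_sub_emod (x := d i - m') (m := 2 * ((n : ℤ) + 1))
    unfold root
    exact congrArg₂ (· - ·) (D.eq_of_dvd ⟨-q, by linear_combination -hq⟩)
      (D.eq_of_dvd ⟨-q, by linear_combination -hq⟩)
  rw [hr] at hβ ⊢
  have hnn := Int.emod_nonneg (d i - m') (show 2 * ((n : ℤ) + 1) ≠ 0 by omega)
  have hlt := Int.emod_lt_of_pos (d i - m') (show 0 < 2 * ((n : ℤ) + 1) by omega)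
  generalize (d i - m') % (2 * ((n : ℤ) + 1)) = t at *
  refine ⟨i, t, by omega, by omega, hnn, ?_, rfl⟩
  by_contra hc
  have h3 := D.isPosRoot_root (i := i) (t := t - ((n : ℤ) + 1)) (by omega) (by omega) (by omega)
    (by omega)
  apply h3.neg_not
  rw [← D.root_add_period]
  simpa using hβ

theorem exists_root (D : SnakeData n d s E e) {β : Vec} (h : IsPosRoot n β) :
    ∃ (i : ℕ) (t : ℤ), 1 ≤ i ∧ i ≤ n ∧ 0 ≤ t ∧ t ≤ n ∧ β = root d E i t := by
  obtain ⟨x, y, σ, hσ, hx, hxy, hy, hβ⟩ := h.exists_eps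
  obtain ⟨m, hm⟩ := D.exists_eq_smul_eps hx (by omega) (Or.inl rfl)
  obtain ⟨m', hm'⟩ := D.exists_eq_smul_eps (σ := -σ) (j := y) (by omega) hy (by omega)
  rw [one_smul] at hm
  have hβ' : β = E m - E m' := by rw [hβ, hm, hm']; module
  have hnd : ¬ ((n : ℤ) + 1) ∣ m - m' := by
    intro hc
    rcases D.eq_or_neg_of_dvd hc with h' | h' <;> rw [hm, hm'] at h' <;>
      have := congrFun h' x <;> simp [eps_apply, hxy.ne] at this
  have hdv := Int.dvd_self_sub_emod (x := m - m') (m := 2 * ((n : ℤ) + 1))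
  have hnn := Int.emod_nonneg (m - m') (show 2 * ((n : ℤ) + 1) ≠ 0 by omega)
  have hlt := Int.emod_lt_of_pos (m - m') (show 0 < 2 * ((n : ℤ) + 1) by omega)
  have hnd' : ¬ ((n : ℤ) + 1) ∣ (m - m') % (2 * ((n : ℤ) + 1)) := by
    intro hc
    apply hnd
    have := dvd_add ((Dvd.intro_left 2 rfl).trans hdv) hc
    simpa using this
  generalize (m - m') % (2 * ((n : ℤ) + 1)) = δ at *
  have hδ0 : δ ≠ 0 := by rintro rfl; exact hnd' (dvd_zero _)
  have hδ1 : δ ≠ (n : ℤ) + 1 := by rintro rfl; exact hnd' dvd_rfl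
  -- When `δ > n + 1` the two terms change roles: antiperiodicity rewrites the root with index
  -- difference `2 (n + 1) - δ`.
  rcases lt_or_ge δ ((n : ℤ) + 1) with hc | hc
  · have : E m = E (m' + δ) := D.eq_of_dvd (by convert hdv using 1; ring)
    rw [this] at hβ'
    rw [hβ'] at h ⊢
    exact D.exists_root_of_sub (by omega) (by omega) h
  · have h1 : E m' = -E (m' + ((n : ℤ) + 1)) := by rw [D.add_period, neg_neg]
    have h2 : E m = -E (m' + δ - ((n : ℤ) + 1)) := by
      rw [← D.add_period]; exact D.eq_of_dvd (by convert hdv using 1; ring)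
    have h3 : β = E (m' + ((n : ℤ) + 1)) - E (m' + δ - ((n : ℤ) + 1)) := by
      rw [hβ', h1, h2]; module
    rw [h3] at h ⊢
    exact D.exists_root_of_sub (by omega) (by omega) h

end SnakeData

/-! ### Sectional paths in the shape and the labelling algorithm -/

theorem mem_shape {n : ℕ} {ξ : ℕ → ℤ} {v : ℕ × ℤ} : v ∈ shape n ξ ↔
    ∃ (i : ℕ) (t : ℤ), 1 ≤ i ∧ i ≤ n ∧ 0 ≤ t ∧ t ≤ n ∧ v = (i, ξ i - 2 * t) := by
  simp only [shape, Finset.mem_image, Finset.mem_product, Finset.mem_Icc, Finset.mem_range,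
    Prod.exists]
  constructor
  · rintro ⟨i, t, ⟨⟨h1, h2⟩, h3⟩, rfl⟩
    exact ⟨i, t, h1, h2, by omega, by omega, rfl⟩
  · rintro ⟨i, t, h1, h2, h3, h4, rfl⟩
    exact ⟨i, t.toNat, ⟨⟨h1, h2⟩, by omega⟩, by rw [Int.toNat_of_nonneg h3]⟩

theorem two_mul_dvd_iff (N x y : ℤ) (h : y = 2 * x) : 2 * N ∣ y ↔ N ∣ x := by
  rw [h]; exact mul_dvd_mul_iff_left two_ne_zero

theorem exists_window (n : ℕ) (x : ℤ) : ∃ t : ℤ, 0 ≤ t ∧ t ≤ n ∧ ((n : ℤ) + 1) ∣ x - t :=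
  ⟨x % ((n : ℤ) + 1), Int.emod_nonneg _ (by omega),
    by have := Int.emod_lt_of_pos x (b := (n : ℤ) + 1) (by omega); omega, Int.dvd_self_sub_emod⟩

theorem eq_zero_or_neg_of_dvd {N x : ℤ} (h : N ∣ x) (h1 : x < N) (h2 : -(2 * N) < x) :
    x = 0 ∨ x = -N := by
  obtain ⟨q, rfl⟩ := h
  have hN : 0 < N := by linarith
  have h3 : q < 1 := by nlinarith
  have h4 : -2 < q := by nlinarith
  rcases (show q = 0 ∨ q = -1 by omega) with rfl | rfl
  · left; ring
  · right; ring

namespace SnakeData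

variable {n : ℕ} {d : ℕ → ℤ} {s : ℤ} {E : ℤ → Vec} {e : ℤ → ℕ} {ξ : ℕ → ℤ}

theorem vertex_mem_nExt (hξ : ∀ i, 1 ≤ i → i ≤ n → ξ i = 2 * d i + i) {i : ℕ} {t m : ℤ}
    (hi : 1 ≤ i) (hin : i ≤ n) (ht : 0 ≤ t) (htn : t ≤ n) :
    (i, ξ i - 2 * t) ∈ nExt n (shape n ξ) m ↔ ((n : ℤ) + 1) ∣ d i - t + i - m := by
  rw [nExt, Finset.mem_filter, and_iff_right (mem_shape.mpr ⟨i, t, hi, hin, ht, htn, rfl⟩)]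
  exact two_mul_dvd_iff _ _ _ (by rw [hξ i hi hin]; ring)

theorem vertex_mem_sExt (hξ : ∀ i, 1 ≤ i → i ≤ n → ξ i = 2 * d i + i) {i : ℕ} {t m : ℤ}
    (hi : 1 ≤ i) (hin : i ≤ n) (ht : 0 ≤ t) (htn : t ≤ n) :
    (i, ξ i - 2 * t) ∈ sExt n (shape n ξ) m ↔ ((n : ℤ) + 1) ∣ d i - t - m := by
  rw [sExt, Finset.mem_filter, and_iff_right (mem_shape.mpr ⟨i, t, hi, hin, ht, htn, rfl⟩)]
  exact two_mul_dvd_iff _ _ _ (by rw [hξ i hi hin]; ring)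

/-- At residue `i` the N-indices fill a window of `n + 1` integers ending at `d i + i`, which
contains exactly one of `r` and `r - (n + 1)`. -/
theorem mem_nExt_iff (D : SnakeData n d s E e) (hξ : ∀ i, 1 ≤ i → i ≤ n → ξ i = 2 * d i + i)
    {r m : ℤ} (hr : r = m % ((n : ℤ) + 1)) {v : ℕ × ℤ} : v ∈ nExt n (shape n ξ) m ↔
      ∃ i : ℕ, 1 ≤ i ∧ i ≤ n ∧
        v = (i, 2 * (if r ≤ d i + i then r else r - ((n : ℤ) + 1)) - i) := by
  have hm := D.emod_mem m
  have hdv := Int.dvd_self_sub_emod (x := m) (m := (n : ℤ) + 1)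
  rw [← hr] at hm hdv
  constructor
  · intro hv
    obtain ⟨i, t, hi, hin, ht, htn, rfl⟩ := mem_shape.mp (Finset.mem_filter.mp hv).1
    rw [vertex_mem_nExt hξ hi hin ht htn] at hv
    have hb := D.height.mem_range hi hin
    refine ⟨i, hi, hin, ?_⟩
    have h3 := dvd_add hv hdv
    rw [show d i - t + i - m + (m - r) = d i - t + i - r by ring] at h3
    rw [hξ i hi hin, Prod.mk.injEq]
    refine ⟨rfl, ?_⟩
    rcases eq_zero_or_neg_of_dvd h3 (by omega) (by omega) with h | h <;> split_ifs <;> omega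
  · rintro ⟨i, hi, hin, rfl⟩
    have hb := D.height.mem_range hi hin
    split_ifs with h
    · rw [show 2 * r - (i : ℤ) = ξ i - 2 * (d i + i - r) by rw [hξ i hi hin]; ring,
        vertex_mem_nExt hξ hi hin (by omega) (by omega)]
      obtain ⟨q, hq⟩ := hdv
      exact ⟨-q, by linear_combination -hq⟩
    · rw [show 2 * (r - ((n : ℤ) + 1)) - (i : ℤ) = ξ i - 2 * (d i + i - (r - ((n : ℤ) + 1))) by
        rw [hξ i hi hin]; ring, vertex_mem_nExt hξ hi hin (by omega) (by omega)]
      obtain ⟨q, hq⟩ := hdv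
      exact ⟨-q - 1, by linear_combination -hq⟩

theorem mem_sExt_iff (D : SnakeData n d s E e) (hξ : ∀ i, 1 ≤ i → i ≤ n → ξ i = 2 * d i + i)
    {r m : ℤ} (hr : r = m % ((n : ℤ) + 1)) {v : ℕ × ℤ} : v ∈ sExt n (shape n ξ) m ↔
      ∃ i : ℕ, 1 ≤ i ∧ i ≤ n ∧
        v = (i, 2 * (if r ≤ d i then r else r - ((n : ℤ) + 1)) + i) := by
  have hm := D.emod_mem m
  have hdv := Int.dvd_self_sub_emod (x := m) (m := (n : ℤ) + 1)
  rw [← hr] at hm hdv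
  constructor
  · intro hv
    obtain ⟨i, t, hi, hin, ht, htn, rfl⟩ := mem_shape.mp (Finset.mem_filter.mp hv).1
    rw [vertex_mem_sExt hξ hi hin ht htn] at hv
    have hb := D.height.mem_range hi hin
    refine ⟨i, hi, hin, ?_⟩
    have h3 := dvd_add hv hdv
    rw [show d i - t - m + (m - r) = d i - t - r by ring] at h3
    rw [hξ i hi hin, Prod.mk.injEq]
    refine ⟨rfl, ?_⟩
    rcases eq_zero_or_neg_of_dvd h3 (by omega) (by omega) with h | h <;> split_ifs <;> omega
  · rintro ⟨i, hi, hin, rfl⟩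
    have hb := D.height.mem_range hi hin
    split_ifs with h
    · rw [show 2 * r + (i : ℤ) = ξ i - 2 * (d i - r) by rw [hξ i hi hin]; ring,
        vertex_mem_sExt hξ hi hin (by omega) (by omega)]
      obtain ⟨q, hq⟩ := hdv
      exact ⟨-q, by linear_combination -hq⟩
    · rw [show 2 * (r - ((n : ℤ) + 1)) + (i : ℤ) = ξ i - 2 * (d i - (r - ((n : ℤ) + 1))) by
        rw [hξ i hi hin]; ring, vertex_mem_sExt hξ hi hin (by omega) (by omega)]
      obtain ⟨q, hq⟩ := hdv
      exact ⟨-q - 1, by linear_combination -hq⟩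

/-- A break can occur only between `e r - 1` and `e r`, where the index jumps by `n + 1`. It is
absent exactly when `r ≤ d i + i` already holds at `i = 1`. -/
theorem isConn_nExt_iff (D : SnakeData n d s E e)
    (hξ : ∀ i, 1 ≤ i → i ≤ n → ξ i = 2 * d i + i) {r m : ℤ} (hr : r = m % ((n : ℤ) + 1)) :
    IsConn (nExt n (shape n ξ) m) ↔ r ≤ d 1 + 1 := by
  have hn := D.two_le
  have hm := D.emod_mem m
  rw [← hr] at hm
  constructor
  · intro hc
    by_contra hlt
    have h1 := D.index.one_le r hm.1 hm.2
    have hh := D.index.high r (by omega) hm.2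
    have h2 : ¬ e r ≤ 1 := fun h => by
      have := (hh 1 le_rfl (by omega)).mp h; push_cast at this; omega
    have h3 : e r ≤ n := (hh n (by omega) le_rfl).mpr (by have := D.height.last; omega)
    have h4 := (hh (e r) h1 h3).mp le_rfl
    have h5 := hh (e r - 1) (by omega) (by omega)
    have h6 : ¬ r ≤ d (e r - 1) + (e r - 1 : ℕ) := fun h => by have := h5.mpr h; omega
    have a := (D.mem_nExt_iff hξ hr).mpr ⟨e r - 1, by omega, by omega, rfl⟩
    have b := (D.mem_nExt_iff hξ hr).mpr ⟨e r, h1, h3, rfl⟩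
    have := hc _ a _ b (by simp only; omega)
    rw [if_neg h6, if_pos h4] at this
    simp only [FoldedArrow] at this
    omega
  · intro hle u hu v hv huv
    obtain ⟨i, hi, hin, rfl⟩ := (D.mem_nExt_iff hξ hr).mp hu
    obtain ⟨j, hj, hjn, rfl⟩ := (D.mem_nExt_iff hξ hr).mp hv
    have hbi := D.height.mem_range hi hin
    have hbj := D.height.mem_range hj hjn
    simp only at huv
    rw [if_pos (by omega), if_pos (by omega)]
    right
    simp only [FoldedArrow]
    omega

/-- Same argument for S-paths. At `r = 0` all vertices lie on the path of index 0, so the path is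
connected although `d 1 < 0` fails; hence `hr0`. -/
theorem isConn_sExt_iff (D : SnakeData n d s E e)
    (hξ : ∀ i, 1 ≤ i → i ≤ n → ξ i = 2 * d i + i) {r m : ℤ} (hr : r = m % ((n : ℤ) + 1))
    (hr0 : r ≠ 0) : IsConn (sExt n (shape n ξ) m) ↔ d 1 < r := by
  have hn := D.two_le
  have hm := D.emod_mem m
  rw [← hr] at hm
  constructor
  · intro hc
    by_contra hlt
    have h1 := D.index.one_le r hm.1 hm.2
    have hh := D.index.low r hm.1 (by omega)
    have h2 : ¬ e r ≤ 1 := fun h => by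
      have := (hh 1 le_rfl (by omega)).mp h; omega
    have h3 : e r ≤ n := (hh n (by omega) le_rfl).mpr (by have := D.height.last; omega)
    have h4 := (hh (e r) h1 h3).mp le_rfl
    have h5 := hh (e r - 1) (by omega) (by omega)
    have h6 : r ≤ d (e r - 1) := by
      by_contra h; have := h5.mpr (by omega); omega
    have a := (D.mem_sExt_iff hξ hr).mpr ⟨e r - 1, by omega, by omega, rfl⟩
    have b := (D.mem_sExt_iff hξ hr).mpr ⟨e r, h1, h3, rfl⟩
    have := hc _ a _ b (by simp only; omega)
    rw [if_pos h6, if_neg (by omega)] at this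
    simp only [FoldedArrow] at this
    omega
  · intro hle u hu v hv huv
    obtain ⟨i, hi, hin, rfl⟩ := (D.mem_sExt_iff hξ hr).mp hu
    obtain ⟨j, hj, hjn, rfl⟩ := (D.mem_sExt_iff hξ hr).mp hv
    have hbi := D.height.mem_range hi hin
    have hbj := D.height.mem_range hj hjn
    simp only at huv
    rw [if_neg (by omega), if_neg (by omega)]
    left
    simp only [FoldedArrow]
    omega

theorem mem_nRight_iff (D : SnakeData n d s E e)
    (hξ : ∀ i, 1 ≤ i → i ≤ n → ξ i = 2 * d i + i) {r m : ℤ} (hr : r = m % ((n : ℤ) + 1))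
    {v : ℕ × ℤ} : v ∈ nRight n (shape n ξ) m ↔
      ∃ i : ℕ, 1 ≤ i ∧ i ≤ n ∧ r ≤ d i + i ∧ v = (i, 2 * r - i) := by
  have hn := D.two_le
  have hm := D.emod_mem m
  rw [← hr] at hm
  rw [nRight, Finset.mem_filter, D.mem_nExt_iff hξ hr]
  have hlast := D.height.last
  constructor
  · rintro ⟨⟨i, hi, hin, rfl⟩, h⟩
    -- Since `d n = 0` and `r ≤ n`, the vertex in residue `n` always has index `r`, so the maximum
    -- is attained there.
    have := h _ ((D.mem_nExt_iff hξ hr).mpr ⟨n, by omega, le_rfl, rfl⟩)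
    rw [if_pos (by omega)] at this
    simp only at this
    have hc : r ≤ d i + i := by
      by_contra hc
      rw [if_neg hc] at this; omega
    exact ⟨i, hi, hin, hc, by rw [if_pos hc]⟩
  · rintro ⟨i, hi, hin, hc, rfl⟩
    refine ⟨⟨i, hi, hin, by rw [if_pos hc]⟩, fun u hu => ?_⟩
    obtain ⟨j, hj, hjn, rfl⟩ := (D.mem_nExt_iff hξ hr).mp hu
    simp only
    split_ifs <;> omega

theorem mem_sRight_iff (D : SnakeData n d s E e)
    (hξ : ∀ i, 1 ≤ i → i ≤ n → ξ i = 2 * d i + i) {r m : ℤ} (hr : r = m % ((n : ℤ) + 1))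
    (hrd : r ≤ d 1) {v : ℕ × ℤ} : v ∈ sRight n (shape n ξ) m ↔
      ∃ i : ℕ, 1 ≤ i ∧ i ≤ n ∧ r ≤ d i ∧ v = (i, 2 * r + i) := by
  have hn := D.two_le
  have hm := D.emod_mem m
  rw [← hr] at hm
  rw [sRight, Finset.mem_filter, D.mem_sExt_iff hξ hr]
  constructor
  · rintro ⟨⟨i, hi, hin, rfl⟩, h⟩
    have := h _ ((D.mem_sExt_iff hξ hr).mpr ⟨1, le_rfl, by omega, rfl⟩)
    rw [if_pos hrd] at this
    simp only at this
    have hc : r ≤ d i := by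
      by_contra hc
      rw [if_neg hc] at this; push_cast at this; omega
    exact ⟨i, hi, hin, hc, by rw [if_pos hc]⟩
  · rintro ⟨i, hi, hin, hc, rfl⟩
    refine ⟨⟨i, hi, hin, by rw [if_pos hc]⟩, fun u hu => ?_⟩
    obtain ⟨j, hj, hjn, rfl⟩ := (D.mem_sExt_iff hξ hr).mp hu
    simp only
    split_ifs <;> omega

theorem card_nRight (D : SnakeData n d s E e) (hξ : ∀ i, 1 ≤ i → i ≤ n → ξ i = 2 * d i + i)
    {r m : ℤ} (hr : r = m % ((n : ℤ) + 1)) (hrd : d 1 < r) :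
    (nRight n (shape n ξ) m).card = n + 1 - e r := by
  have hm := D.emod_mem m
  rw [← hr] at hm
  have : nRight n (shape n ξ) m = (Finset.Icc (e r) n).image (fun i : ℕ => (i, 2 * r - (i : ℤ))) := by
    ext v
    rw [D.mem_nRight_iff hξ hr, Finset.mem_image]
    constructor
    · rintro ⟨i, hi, hin, hc, rfl⟩
      exact ⟨i, Finset.mem_Icc.mpr ⟨(D.index.high r hrd hm.2 i hi hin).mpr hc, hin⟩, rfl⟩
    · rintro ⟨i, hi, rfl⟩
      rw [Finset.mem_Icc] at hi
      have h1 := D.index.one_le r hm.1 hm.2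
      exact ⟨i, by omega, hi.2, (D.index.high r hrd hm.2 i (by omega) hi.2).mp hi.1, rfl⟩
  rw [this, Finset.card_image_of_injective _ fun i j h => (Prod.mk.inj h).1, Nat.card_Icc]

theorem card_sRight (D : SnakeData n d s E e) (hξ : ∀ i, 1 ≤ i → i ≤ n → ξ i = 2 * d i + i)
    {r m : ℤ} (hr : r = m % ((n : ℤ) + 1)) (hrd : r ≤ d 1) :
    (sRight n (shape n ξ) m).card + 1 = e r := by
  have hm := D.emod_mem m
  rw [← hr] at hm
  have hle := D.index.le r hm.1 hm.2
  have h1 := D.index.one_le r hm.1 hm.2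
  have : sRight n (shape n ξ) m =
      (Finset.Ico 1 (e r)).image (fun i : ℕ => (i, 2 * r + (i : ℤ))) := by
    ext v
    rw [D.mem_sRight_iff hξ hr hrd, Finset.mem_image]
    constructor
    · rintro ⟨i, hi, hin, hc, rfl⟩
      have := D.index.low r hm.1 hrd i hi hin
      exact ⟨i, Finset.mem_Ico.mpr ⟨hi, by omega⟩, rfl⟩
    · rintro ⟨i, hi, rfl⟩
      rw [Finset.mem_Ico] at hi
      have := D.index.low r hm.1 hrd i hi.1 (by omega)
      exact ⟨i, hi.1, by omega, by omega, rfl⟩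
  rw [this, Finset.card_image_of_injective _ fun i j h => (Prod.mk.inj h).1, Nat.card_Ico]
  omega

theorem snakeNumber_eq (D : SnakeData n d s E e)
    (hξ : ∀ i, 1 ≤ i → i ≤ n → ξ i = 2 * d i + i) (m : ℤ) :
    snakeNumber n (shape n ξ) m = e (m % ((n : ℤ) + 1)) := by
  obtain ⟨r, hr⟩ : ∃ r, r = m % ((n : ℤ) + 1) := ⟨_, rfl⟩
  have hm := D.emod_mem m
  have hn := D.one_le
  rw [← hr] at hm ⊢
  unfold snakeNumber
  split_ifs with h1 h2 h3
  · rw [hr, Int.emod_eq_zero_of_dvd h1, D.index.zero hn D.height]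
  · have hr0 : r ≠ 0 := fun h => h1 (Int.dvd_of_emod_eq_zero (hr ▸ h))
    rw [D.isConn_sExt_iff hξ hr hr0] at h3
    rw [D.isConn_nExt_iff hξ hr] at h2
    -- Both paths being connected forces `r = d 1 + 1`, so the threshold is already met at residue
    -- 1.
    have h4 := (D.index.high r h3 hm.2 1 le_rfl hn).mpr (by push_cast; omega)
    have := D.index.one_le r hm.1 hm.2
    omega
  · have hr0 : r ≠ 0 := fun h => h1 (Int.dvd_of_emod_eq_zero (hr ▸ h))
    rw [D.isConn_sExt_iff hξ hr hr0] at h3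
    exact D.card_sRight hξ hr (by omega)
  · rw [D.isConn_nExt_iff hξ hr] at h2
    rw [D.card_nRight hξ hr (by omega)]
    have := D.index.le r hm.1 hm.2
    omega

/-- The index `m` is its residue `r` or `r - (n + 1)`, and for `r ≠ 0` the sign of `E m` tells
which. The right part consists of the vertices of index `r`, and connectedness forces `m = r`. -/
theorem signedEps_nSummand (D : SnakeData n d s E e)
    (hξ : ∀ i, 1 ≤ i → i ≤ n → ξ i = 2 * d i + i) {hasN : Bool}
    (hs : s = if hasN then 1 else -1) {i : ℕ} {t : ℤ}
    (hi : 1 ≤ i) (hin : i ≤ n) (ht : 0 ≤ t) (htn : t ≤ n) :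
    signedEps (nSummand n (shape n ξ) hasN (d i - t + i) (i, ξ i - 2 * t)) =
      E (d i - t + i) := by
  obtain ⟨m, hmd⟩ : ∃ m, m = d i - t + i := ⟨_, rfl⟩
  obtain ⟨r, hr⟩ : ∃ r, r = m % ((n : ℤ) + 1) := ⟨_, rfl⟩
  have hm := D.emod_mem m
  have hn := D.one_le
  have hb := D.height.mem_range hi hin
  have hdv := Int.dvd_self_sub_emod (x := m) (m := (n : ℤ) + 1)
  rw [← hr] at hm hdv
  have hone := D.index.one_le r hm.1 hm.2
  have hmr : m = r ∨ m = r - ((n : ℤ) + 1) := by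
    rcases eq_zero_or_neg_of_dvd hdv (by omega) (by omega) with h | h <;> omega
  rw [← hmd]
  unfold nSummand
  split_ifs with h1 h2 h3
  · rw [Int.emod_eq_zero_of_dvd h1] at hr
    have hm0 : m = 0 := by omega
    rw [hm0, D.apply_of_mem le_rfl (by omega), D.index.zero hn D.height, if_pos rfl, hs, if_pos h2,
      one_smul]
    exact_mod_cast signedEps_natCast (n + 1) (by omega)
  · rw [Int.emod_eq_zero_of_dvd h1] at hr
    have hm0 : m = 0 := by omega
    rw [hm0, D.apply_of_mem le_rfl (by omega), D.index.zero hn D.height, if_pos rfl, hs, if_neg h2,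
      neg_one_smul]
    exact_mod_cast signedEps_neg_natCast (n + 1) (by omega)
  · have hr0 : r ≠ 0 := fun h => h1 (Int.dvd_of_emod_eq_zero (hr ▸ h))
    have : m = r := by
      rcases h3 with h3 | h3
      · rw [D.isConn_nExt_iff hξ hr] at h3; omega
      · obtain ⟨j, _, _, _, h4⟩ := (D.mem_nRight_iff hξ hr).mp h3
        rw [hξ i hi hin, Prod.mk.injEq] at h4
        obtain ⟨rfl, h4⟩ := h4
        omega
    rw [D.snakeNumber_eq hξ, ← hr, signedEps_natCast _ hone, this, D.apply_of_mem hm.1 hm.2,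
      if_neg hr0, one_smul]
  · have hr0 : r ≠ 0 := fun h => h1 (Int.dvd_of_emod_eq_zero (hr ▸ h))
    push Not at h3
    have : m = r - ((n : ℤ) + 1) := by
      refine hmr.resolve_left fun h => h3.2 ((D.mem_nRight_iff hξ hr).mpr
        ⟨i, hi, hin, by omega, ?_⟩)
      rw [hξ i hi hin, Prod.mk.injEq]
      exact ⟨rfl, by omega⟩
    have hE := D.add_period m
    rw [show m + ((n : ℤ) + 1) = r by omega, D.apply_of_mem hm.1 hm.2, if_neg hr0, one_smul] at hE
    rw [D.snakeNumber_eq hξ, ← hr, signedEps_neg_natCast _ hone, hE, neg_neg]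

/-- As for N-paths, but `E` enters with a minus sign and a connected S-path with `r ≠ 0` has index
`r - (n + 1)`, so the right part is now the negative one. -/
theorem signedEps_sSummand (D : SnakeData n d s E e)
    (hξ : ∀ i, 1 ≤ i → i ≤ n → ξ i = 2 * d i + i) {hasN : Bool}
    (hs : s = if hasN then 1 else -1) {i : ℕ} {t : ℤ}
    (hi : 1 ≤ i) (hin : i ≤ n) (ht : 0 ≤ t) (htn : t ≤ n) :
    signedEps (sSummand n (shape n ξ) hasN (d i - t) (i, ξ i - 2 * t)) = -E (d i - t) := by
  obtain ⟨m, hmd⟩ : ∃ m, m = d i - t := ⟨_, rfl⟩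
  obtain ⟨r, hr⟩ : ∃ r, r = m % ((n : ℤ) + 1) := ⟨_, rfl⟩
  have hm := D.emod_mem m
  have hn := D.one_le
  have hb := D.height.mem_range hi hin
  have hdv := Int.dvd_self_sub_emod (x := m) (m := (n : ℤ) + 1)
  rw [← hr] at hm hdv
  have hone := D.index.one_le r hm.1 hm.2
  have hmr : m = r ∨ m = r - ((n : ℤ) + 1) := by
    rcases eq_zero_or_neg_of_dvd hdv (by omega) (by omega) with h | h <;> omega
  rw [← hmd]
  unfold sSummand
  split_ifs with h1 h2 h3
  · rw [Int.emod_eq_zero_of_dvd h1] at hr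
    have hm0 : m = 0 := by omega
    rw [hm0, D.apply_of_mem le_rfl (by omega), D.index.zero hn D.height, if_pos rfl, hs, if_pos h2,
      one_smul]
    exact_mod_cast signedEps_neg_natCast (n + 1) (by omega)
  · rw [Int.emod_eq_zero_of_dvd h1] at hr
    have hm0 : m = 0 := by omega
    rw [hm0, D.apply_of_mem le_rfl (by omega), D.index.zero hn D.height, if_pos rfl, hs, if_neg h2,
      neg_one_smul, neg_neg]
    exact_mod_cast signedEps_natCast (n + 1) (by omega)
  · have hr0 : r ≠ 0 := fun h => h1 (Int.dvd_of_emod_eq_zero (hr ▸ h))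
    have : m = r - ((n : ℤ) + 1) := by
      refine hmr.resolve_left fun h => ?_
      rcases h3 with h3 | h3
      · rw [D.isConn_sExt_iff hξ hr hr0] at h3; omega
      · refine h3 ((D.mem_sRight_iff hξ hr (by omega)).mpr ⟨i, hi, hin, by omega, ?_⟩)
        rw [hξ i hi hin, Prod.mk.injEq]
        exact ⟨rfl, by omega⟩
    have hE := D.add_period m
    rw [show m + ((n : ℤ) + 1) = r by omega, D.apply_of_mem hm.1 hm.2, if_neg hr0, one_smul] at hE
    rw [D.snakeNumber_eq hξ, ← hr, signedEps_natCast _ hone, hE]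
  · have hr0 : r ≠ 0 := fun h => h1 (Int.dvd_of_emod_eq_zero (hr ▸ h))
    push Not at h3
    rw [D.isConn_sExt_iff hξ hr hr0] at h3
    have : m = r := by
      obtain ⟨j, _, _, _, h4⟩ := (D.mem_sRight_iff hξ hr (by omega)).mp h3.2
      rw [hξ i hi hin, Prod.mk.injEq] at h4
      obtain ⟨rfl, h4⟩ := h4
      omega
    rw [D.snakeNumber_eq hξ, ← hr, signedEps_neg_natCast _ hone, this, D.apply_of_mem hm.1 hm.2,
      if_neg hr0, one_smul]

theorem root_eq_label (D : SnakeData n d s E e)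
    (hξ : ∀ i, 1 ≤ i → i ≤ n → ξ i = 2 * d i + i) {hasN : Bool}
    (hs : s = if hasN then 1 else -1) {i : ℕ} {t : ℤ}
    (hi : 1 ≤ i) (hin : i ≤ n) (ht : 0 ≤ t) (htn : t ≤ n) :
    root d E i t = signedEps (label n (shape n ξ) hasN (i, ξ i - 2 * t)).1 +
      signedEps (label n (shape n ξ) hasN (i, ξ i - 2 * t)).2 := by
  have h1 : (ξ i - 2 * t + i) / 2 = d i - t + i := by rw [hξ i hi hin]; omega
  have h2 : (ξ i - 2 * t - i) / 2 = d i - t := by rw [hξ i hi hin]; omega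
  simp only [label, h1, h2]
  rw [D.signedEps_nSummand hξ hs hi hin ht htn, D.signedEps_sSummand hξ hs hi hin ht htn, root,
    sub_eq_add_neg]

end SnakeData

/-! ### The height function and sign of a twisted Coxeter word -/

theorem IsTwistedCoxeterWord.nodup {n : ℕ} {c : List ℕ} (hc : IsTwistedCoxeterWord n c) :
    (c.map (fold n)).Nodup := hc.nodup_iff.mpr List.nodup_range'

theorem IsTwistedCoxeterWord.count_eq_one {n : ℕ} {c : List ℕ} (hc : IsTwistedCoxeterWord n c)
    {i : ℕ} (hi : 1 ≤ i) (hin : i ≤ n) : (c.map (fold n)).count i = 1 :=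
  List.count_eq_one_of_mem hc.nodup ((hc.mem_fold i).mpr ⟨hi, hin⟩)

theorem IsTwistedCoxeterWord.not_mem_of_last_mem {n : ℕ} {c : List ℕ}
    (hc : IsTwistedCoxeterWord n c) (h : n + 1 ∈ c) : n ∉ c := by
  intro h'
  have := List.inj_on_of_nodup_map hc.nodup h h'
  rw [fold_last, fold_eq_self (by omega)] at this
  have := this rfl
  omega

theorem IsTwistedCoxeterWord.fold_mem {n : ℕ} {c : List ℕ} (hc : IsTwistedCoxeterWord n c)
    {k : ℕ} (hk : k ∈ c) : 1 ≤ fold n k ∧ fold n k ≤ n :=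
  (hc.mem_fold _).mp (List.mem_map_of_mem hk)

theorem IsTwistedCoxeterWord.exists_mem {n : ℕ} {c : List ℕ} (hc : IsTwistedCoxeterWord n c)
    {i : ℕ} (hi : 1 ≤ i) (hin : i ≤ n) : ∃ k ∈ c, fold n k = i :=
  List.mem_map.mp ((hc.mem_fold i).mpr ⟨hi, hin⟩)

theorem map_fold_map_vee (n : ℕ) (c : List ℕ) :
    (c.map (vee n)).map (fold n) = c.map (fold n) := by
  rw [List.map_map]
  exact List.map_congr_left fun x _ => fold_vee n x

/-- The function `d` with `ξ(i) = 2 d(i) + i`. -/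
def halfHeight (n : ℕ) (c : List ℕ) (i : ℕ) : ℤ :=
  (arrowsToOne n c : ℤ) - ((Finset.Icc 1 (i - 1)).filter (fun k => QArrow n c (k + 1) k)).card

theorem halfHeight_succ (n : ℕ) (c : List ℕ) {k : ℕ} (hk : 1 ≤ k) :
    halfHeight n c (k + 1) = halfHeight n c k - if QArrow n c (k + 1) k then 1 else 0 := by
  unfold halfHeight
  have : Finset.Icc 1 (k + 1 - 1) = insert k (Finset.Icc 1 (k - 1)) := by
    ext x; simp only [Finset.mem_Icc, Finset.mem_insert]; omega
  rw [this, Finset.filter_insert]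
  split_ifs
  · rw [Finset.card_insert_of_notMem (by
      simp only [Finset.mem_filter, Finset.mem_Icc]; omega)]
    push_cast; ring
  · ring

theorem isShapeHeight_halfHeight (n : ℕ) (c : List ℕ) : IsShapeHeight n (halfHeight n c) := by
  refine ⟨fun k hk _ => ?_, sub_self _⟩
  rw [halfHeight_succ n c hk]
  split_ifs
  · exact Or.inr rfl
  · exact Or.inl (sub_zero _)

theorem IsTwistedCoxeterWord.idxOf_ne {n : ℕ} {c : List ℕ} (hc : IsTwistedCoxeterWord n c)
    {k : ℕ} (hk : 1 ≤ k) (hkn : k < n) :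
    (c.map (fold n)).idxOf k ≠ (c.map (fold n)).idxOf (k + 1) := by
  intro h
  have := (List.idxOf_inj ((hc.mem_fold k).mpr ⟨hk, hkn.le⟩)).mp h
  omega

/-- Neighbouring residues are joined by exactly one arrow, so `ξ i - i` drops by 2 along an arrow
toward 1 and is constant otherwise. The normalisation at 1 then gives `d n = 0`. -/
theorem IsHeight.eq_halfHeight {n : ℕ} {c : List ℕ} {ξ : ℕ → ℤ} (hc : IsTwistedCoxeterWord n c)
    (hξ : IsHeight n c ξ) : ∀ i, 1 ≤ i → i ≤ n → ξ i = 2 * halfHeight n c i + i := by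
  intro i hi
  induction i, hi using Nat.le_induction with
  | base => intro _; rw [hξ.2]; simp [halfHeight]
  | succ k hk ih =>
    intro hkn
    have ih := ih (by omega)
    have hne := hc.idxOf_ne hk hkn
    rw [halfHeight_succ n c hk]
    split_ifs with h
    · have := hξ.1 _ _ h
      push_cast; omega
    · have h' : QArrow n c k (k + 1) := by
        unfold QArrow at h ⊢; omega
      have := hξ.1 _ _ h'
      push_cast; omega

/-- The shift `x` is the number of blocks already fired: 0 for `c`, 1 for `c^∨`. -/
theorem isCompatible_halfHeight {n : ℕ} {c : List ℕ} (x : ℤ) {d : ℕ → ℤ}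
    (hd : ∀ i, 1 ≤ i → i ≤ n → d i = halfHeight n c i - x) :
    IsCompatible n d (c.map (fold n)) := by
  intro k hk hkn
  rw [hd k hk hkn.le, hd (k + 1) (by omega) hkn, halfHeight_succ n c hk]
  constructor
  · intro h
    rw [if_pos (by unfold QArrow; omega)]; ring
  · intro h
    rw [if_neg (by unfold QArrow; omega)]; ring

/-- The sign attached to a twisted Coxeter word. -/
def coxeterSign (n : ℕ) (c : List ℕ) : ℤ := if n ∈ c then 1 else -1

/-- Firing `c` lowers every height by one and flips the sign once, at the fork. The flipped sign is
the one required by `c^∨`, which contains the other of `n`, `n + 1`. -/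
theorem IsTwistedCoxeterWord.isFireableWord {n : ℕ} (hn : 1 ≤ n) {c : List ℕ}
    (hc : IsTwistedCoxeterWord n c) :
    IsFireableWord n (halfHeight n c) (coxeterSign n c) (c ++ c.map (vee n)) := by
  have hnl := hc.not_mem_of_last_mem
  have hmem := fun i => (hc.mem_fold i).mp
  rw [isFireableWord_append]
  refine ⟨(isCompatible_halfHeight 0 (by simp)).isFireableWord hc.nodup hmem
    (fun h => if_pos h) (fun h => if_neg (hnl h)), ?_⟩
  rw [hc.count_eq_one hn le_rfl]
  have hcomp : IsCompatible n (wordHeight n (halfHeight n c) c)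
      ((c.map (vee n)).map (fold n)) := by
    rw [map_fold_map_vee]
    refine isCompatible_halfHeight 1 fun i hi hin => ?_
    rw [wordHeight, hc.count_eq_one hi hin]; rfl
  refine hcomp.isFireableWord (by rw [map_fold_map_vee]; exact hc.nodup)
    (by rw [map_fold_map_vee]; exact hmem) (fun h => ?_) (fun h => ?_)
  · obtain ⟨k, hk, hkn⟩ := List.mem_map.mp h
    have : k = n + 1 := by unfold vee at hkn; split_ifs at hkn <;> omega
    rw [coxeterSign, if_neg (hnl (this ▸ hk))]; norm_num
  · obtain ⟨k, hk, hkn⟩ := List.mem_map.mp h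
    have : k = n := by unfold vee at hkn; split_ifs at hkn <;> omega
    rw [coxeterSign, if_pos (this ▸ hk)]; norm_num

theorem snakePos_sub {n : ℕ} (hn : 1 ≤ n) {d d' : ℕ → ℤ} {x : ℤ}
    (h : ∀ i, 1 ≤ i → i ≤ n → d' i = d i - x) {j : ℕ} (hj : 1 ≤ j) (hjn : j ≤ n + 1) :
    snakePos n d' j = snakePos n d j - x := by
  unfold snakePos
  rw [h 1 le_rfl hn, h n hn le_rfl]
  by_cases h1 : j = 1
  · rw [if_pos h1, if_pos h1]; ring
  · by_cases h2 : j = n + 1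
    · rw [if_neg h1, if_neg h1, if_pos h2, if_pos h2]
    · rw [if_neg h1, if_neg h1, if_neg h2, if_neg h2, h j hj (by omega),
        h (j - 1) (by omega) (by omega)]
      split_ifs <;> omega

theorem exists_snakeData {n : ℕ} (hn : 2 ≤ n) (c : List ℕ) :
    ∃ E e, SnakeData n (halfHeight n c) (coxeterSign n c) E e := by
  have hd := isShapeHeight_halfHeight n c
  obtain ⟨e, he⟩ := hd.exists_snakeIndex
  obtain ⟨E, hE⟩ := he.exists_labelling (by omega) hd (coxeterSign n c)
  refine ⟨E, e, hn, hd, he, hE, ?_⟩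
  unfold coxeterSign
  split_ifs
  exacts [Or.inl rfl, Or.inr rfl]

/-! ### Coordinates in the twisted AR-quiver -/

namespace SnakeData

variable {n : ℕ} {c : List ℕ} {ξ : ℕ → ℤ} {E : ℤ → Vec} {e : ℤ → ℕ}

/-- The labelling reached after `c c^∨` belongs to the height function shifted by 2 and to the
original sign. A labelling is determined by these data, so it is `E` shifted by 2. -/
theorem wordAct_double (D : SnakeData n (halfHeight n c) (coxeterSign n c) E e)
    (hc : IsTwistedCoxeterWord n c) (m : ℤ) :
    wordAct n (c ++ c.map (vee n)) (E m) = E (m - 2) := by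
  have hn := D.one_le
  obtain ⟨E', hE', hact⟩ := D.labelling.exists_wordAct (hc.isFireableWord hn)
  have hcount : ∀ i, 1 ≤ i → i ≤ n → ((c ++ c.map (vee n)).map (fold n)).count i = 2 := by
    intro i hi hin
    rw [List.map_append, map_fold_map_vee, List.count_append, hc.count_eq_one hi hin]
  rw [hcount n hn le_rfl] at hE'
  have hpos : ∀ j, 1 ≤ j → j ≤ n + 1 → snakePos n (wordHeight n (halfHeight n c)
      (c ++ c.map (vee n))) j = snakePos n (halfHeight n c) j - 2 := fun j hj hjn =>
    snakePos_sub hn (fun i hi hin => by rw [wordHeight, hcount i hi hin]; rfl) hj hjn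
  have key : ∀ r : ℤ, 0 ≤ r → r ≤ n → E' (r - 2) = E r := by
    intro r h0 hr
    rw [← D.index.snakePos_eq hn D.height h0 hr]
    have h1 := D.index.one_le r h0 hr
    have h2 := D.index.le r h0 hr
    rw [← hpos _ h1 h2]
    by_cases h3 : e r = n + 1
    · rw [h3, hE'.last, D.labelling.last]; norm_num
    · rw [hE'.eps _ h1 (by omega), D.labelling.eps _ h1 (by omega)]
  have hall : ∀ m, E' (m - 2) = E m := by
    intro m
    obtain ⟨q, hq⟩ := Int.dvd_self_sub_emod (x := m) (m := (n : ℤ) + 1)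
    have hm := D.emod_mem m
    have h1 := D.labelling.antiperiodic.add_zsmul_eq (x := m % ((n : ℤ) + 1)) q
    have h2 := hE'.antiperiodic.add_zsmul_eq (x := m % ((n : ℤ) + 1) - 2) q
    rw [key _ hm.1 hm.2, ← h1, smul_eq_mul] at h2
    rw [show m - 2 = m % ((n : ℤ) + 1) - 2 + q * ((n : ℤ) + 1) by linear_combination hq, h2]
    congr 1
    linear_combination -hq
  rw [← hact (m - 2), hall]

theorem wordAct_double_root (D : SnakeData n (halfHeight n c) (coxeterSign n c) E e)
    (hc : IsTwistedCoxeterWord n c) (i : ℕ) (t : ℤ) :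
    wordAct n (c ++ c.map (vee n)) (root (halfHeight n c) E i t) =
      root (halfHeight n c) E i (t + 2) := by
  unfold root
  rw [wordAct_sub, D.wordAct_double hc, D.wordAct_double hc]
  congr 2 <;> ring

theorem count_eq_zero_of_split (hc : IsTwistedCoxeterWord n c) {u v : List ℕ} {i : ℕ}
    (h : c = u ++ i :: v) : (u.map (fold n)).count (fold n i) = 0 := by
  have := hc.nodup
  rw [h, List.map_append, List.map_cons, List.nodup_append] at this
  rw [List.count_eq_zero]
  exact fun hm => this.2.2 _ hm _ (by simp) rfl

theorem wordAct_first (D : SnakeData n (halfHeight n c) (coxeterSign n c) E e)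
    (hc : IsTwistedCoxeterWord n c) {u v : List ℕ} {i : ℕ} (h : c = u ++ i :: v) :
    wordAct n u (simpleRoot n i) = root (halfHeight n c) E (fold n i) 0 := by
  have hf := ((isFireableWord_append _ _).mp (hc.isFireableWord D.one_le)).1
  have h0 := count_eq_zero_of_split hc h
  -- The first two occurrences of `c` sit in the height function and the sign, and must stay.
  nth_rw 3 [h] at hf
  rw [D.labelling.wordAct_simpleRoot hf, wordHeight, h0]
  rfl

theorem wordAct_second (D : SnakeData n (halfHeight n c) (coxeterSign n c) E e)
    (hc : IsTwistedCoxeterWord n c) {u v : List ℕ} {i : ℕ} (h : c = u ++ i :: v) :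
    wordAct n (c ++ u.map (vee n)) (simpleRoot n (vee n i)) =
      root (halfHeight n c) E (fold n i) 1 := by
  have hf := hc.isFireableWord D.one_le
  have h0 := count_eq_zero_of_split hc h
  have hi := hc.fold_mem (k := i) (by rw [h]; simp)
  have hw : c ++ c.map (vee n) = (c ++ u.map (vee n)) ++ vee n i :: v.map (vee n) := by
    conv_lhs => rw [h]
    conv_rhs => rw [h]
    simp
  rw [hw] at hf
  have h1 := D.labelling.wordAct_simpleRoot hf
  rw [h1, wordHeight, fold_vee, List.map_append, map_fold_map_vee, List.count_append, h0,
    hc.count_eq_one hi.1 hi.2]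
  rfl

theorem exists_of_hasCoord (D : SnakeData n (halfHeight n c) (coxeterSign n c) E e)
    (hc : IsTwistedCoxeterWord n c) {β : Vec} {i : ℕ} {p : ℤ} (h : HasCoord n c ξ β i p) :
    ∃ k ∈ c, ∃ t : ℕ, t ≤ n ∧ i = (vee n)^[t] k ∧ p = ξ (fold n k) - 2 * (t : ℤ) ∧
      β = root (halfHeight n c) E (fold n k) t := by
  have hn := D.two_le
  induction h with
  | first u v i h =>
    exact ⟨i, by rw [h]; simp, 0, by omega, rfl, by simp, D.wordAct_first hc h⟩
  | second u v i h =>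
    exact ⟨i, by rw [h]; simp, 1, by omega, rfl, by simp, D.wordAct_second hc h⟩
  | next β i p h hβ hψ ih =>
    obtain ⟨k, hk, t, ht, rfl, rfl, rfl⟩ := ih
    rw [D.wordAct_double_root hc] at hψ ⊢
    have hf := hc.fold_mem hk
    refine ⟨k, hk, t + 2, ?_, ?_, by push_cast; ring, by push_cast; rfl⟩
    -- Past `t = n` the root is the negative of a positive one, contradicting `hψ`.
    · by_contra hlt
      have h1 := D.root_add_period (fold n k) ((t : ℤ) + 2 - ((n : ℤ) + 1))
      rw [sub_add_cancel] at h1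
      rw [h1] at hψ
      exact (D.isPosRoot_root (t := (t : ℤ) + 2 - ((n : ℤ) + 1)) hf.1 hf.2 (by omega)
        (by omega)).neg_not hψ
    · rw [Function.iterate_succ_apply', Function.iterate_succ_apply', vee_vee]

theorem hasCoord_root (D : SnakeData n (halfHeight n c) (coxeterSign n c) E e)
    (hc : IsTwistedCoxeterWord n c) {k : ℕ} (hk : k ∈ c) (t : ℕ) (ht : t ≤ n) :
    HasCoord n c ξ (root (halfHeight n c) E (fold n k) t) ((vee n)^[t] k)
      (ξ (fold n k) - 2 * (t : ℤ)) := by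
  obtain ⟨u, v, h⟩ := List.append_of_mem hk
  have hf := hc.fold_mem hk
  induction t using Nat.twoStepInduction with
  | zero =>
    have := HasCoord.first (n := n) (ξ := ξ) u v k h
    rw [D.wordAct_first hc h] at this
    simpa using this
  | one =>
    have := HasCoord.second (n := n) (ξ := ξ) u v k h
    rw [D.wordAct_second hc h] at this
    simpa using this
  | more t ih _ =>
    have h1 := D.isPosRoot_root (t := t) hf.1 hf.2 (by omega) (by omega)
    have h2 := D.isPosRoot_root (t := (t : ℤ) + 2) hf.1 hf.2 (by omega) (by omega)
    rw [← D.wordAct_double_root hc] at h2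
    have := HasCoord.next _ _ _ (ih (by omega)) h1 h2
    rw [D.wordAct_double_root hc] at this
    rw [Function.iterate_succ_apply', Function.iterate_succ_apply', vee_vee]
    convert this using 1 <;> push_cast <;> ring

/-- The dictionary that eliminates words: from here on vertices and roots are handled through `E`
alone. -/
theorem hasFoldedCoord_iff (D : SnakeData n (halfHeight n c) (coxeterSign n c) E e)
    (hc : IsTwistedCoxeterWord n c) {β : Vec} {v : ℕ × ℤ} : HasFoldedCoord n c ξ β v ↔
      ∃ (i : ℕ) (t : ℤ), 1 ≤ i ∧ i ≤ n ∧ 0 ≤ t ∧ t ≤ n ∧ v = (i, ξ i - 2 * t) ∧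
        β = root (halfHeight n c) E i t := by
  constructor
  · rintro ⟨i, h, hv⟩
    obtain ⟨k, hk, t, ht, rfl, hp, hβ⟩ := D.exists_of_hasCoord hc h
    have hf := hc.fold_mem hk
    rw [fold_vee_iterate] at hv
    exact ⟨fold n k, t, hf.1, hf.2, by omega, by omega, Prod.ext hv.symm hp, hβ⟩
  · rintro ⟨i, t, hi, hin, ht, htn, rfl, rfl⟩
    obtain ⟨k, hk, rfl⟩ := hc.exists_mem hi hin
    lift t to ℕ using ht
    exact ⟨_, D.hasCoord_root hc hk t (by omega), fold_vee_iterate n t k⟩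

theorem existsUnique_coord (D : SnakeData n (halfHeight n c) (coxeterSign n c) E e)
    (hc : IsTwistedCoxeterWord n c) {β : Vec} (hβ : IsPosRoot n β) :
    ∃! x : ℕ × ℤ, HasCoord n c ξ β x.1 x.2 := by
  obtain ⟨i, t, hi, hin, ht, htn, rfl⟩ := D.exists_root hβ
  obtain ⟨k, hk, rfl⟩ := hc.exists_mem hi hin
  lift t to ℕ using ht
  refine ⟨(_, _), D.hasCoord_root hc hk t (by omega), fun x hx => ?_⟩
  obtain ⟨k', hk', t', ht', h1, h2, h3⟩ := D.exists_of_hasCoord hc hx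
  have hf := hc.fold_mem hk'
  obtain ⟨h4, h5⟩ := D.root_injective hi hin hf.1 hf.2 (by omega) (by omega) (by omega)
    (by omega) h3
  have h6 : k = k' := List.inj_on_of_nodup_map hc.nodup hk hk' h4
  have h7 : t = t' := by omega
  subst h6 h7
  exact Prod.ext h1 h2

theorem root_apply_ne_zero_iff {d : ℕ → ℤ} {s : ℤ} (D : SnakeData n d s E e) {i : ℕ} {t : ℤ}
    (hi : 1 ≤ i) (hin : i ≤ n) (p : ℕ) : root d E i t p ≠ 0 ↔
      p = e ((d i - t + i) % ((n : ℤ) + 1)) ∨ p = e ((d i - t) % ((n : ℤ) + 1)) :=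
  D.sub_apply_ne_zero_iff (not_dvd hi hin _) p

theorem vertex_mem_snake {d : ℕ → ℤ} {s : ℤ} (D : SnakeData n d s E e)
    (hξ : ∀ i, 1 ≤ i → i ≤ n → ξ i = 2 * d i + i) {i : ℕ} {t m : ℤ} (hi : 1 ≤ i) (hin : i ≤ n)
    (ht : 0 ≤ t) (htn : t ≤ n) : (i, ξ i - 2 * t) ∈ snake n (shape n ξ) m ↔
      root d E i t (e (m % ((n : ℤ) + 1))) ≠ 0 := by
  rw [snake, Finset.mem_union, vertex_mem_nExt hξ hi hin ht htn, vertex_mem_sExt hξ hi hin ht htn,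
    D.root_apply_ne_zero_iff hi hin, ← D.index_eq_iff, ← D.index_eq_iff]
  exact or_congr eq_comm eq_comm

theorem index_mem {d : ℕ → ℤ} {s : ℤ} (D : SnakeData n d s E e) (m : ℤ) :
    1 ≤ e (m % ((n : ℤ) + 1)) ∧ e (m % ((n : ℤ) + 1)) ≤ n + 1 :=
  ⟨D.index.one_le _ (D.emod_mem m).1 (D.emod_mem m).2,
    D.index.le _ (D.emod_mem m).1 (D.emod_mem m).2⟩

theorem isSnakeOf_iff (D : SnakeData n (halfHeight n c) (coxeterSign n c) E e)
    (hc : IsTwistedCoxeterWord n c)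
    (hξ : ∀ i, 1 ≤ i → i ≤ n → ξ i = 2 * halfHeight n c i + i) {p : ℕ} (hp : 1 ≤ p) (m : ℤ) :
    IsSnakeOf n c ξ p m ↔ p = e (m % ((n : ℤ) + 1)) := by
  have hn := D.two_le
  constructor
  · intro h
    have key : ∀ i : ℕ, 1 ≤ i → i ≤ n →
        p = e (m % ((n : ℤ) + 1)) ∨ p = e ((m - i) % ((n : ℤ) + 1)) := by
      intro i hi hin
      obtain ⟨t, ht, htn, hdv⟩ := exists_window n (halfHeight n c i + i - m)
      have hx : ((n : ℤ) + 1) ∣ halfHeight n c i - t + i - m := by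
        obtain ⟨q, hq⟩ := hdv; exact ⟨q, by linear_combination hq⟩
      have hx' : ((n : ℤ) + 1) ∣ halfHeight n c i - t - (m - i) := by
        obtain ⟨q, hq⟩ := hdv; exact ⟨q, by linear_combination hq⟩
      have hpos := D.isPosRoot_root hi hin ht htn
      have := h _ (Finset.mem_union_left _ ((vertex_mem_nExt hξ hi hin ht htn).mpr hx)) _ hpos
        ((D.hasFoldedCoord_iff hc).mpr ⟨i, t, hi, hin, ht, htn, rfl, rfl⟩)
      rwa [hpos.isSummand_iff hp, D.root_apply_ne_zero_iff hi hin, D.index_eq_iff.mpr hx,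
        D.index_eq_iff.mpr hx'] at this
    by_contra hne
    -- Two vertices of the N-part suffice: in residues 1 and 2 the other summands have indices `m -
    -- 1` and `m - 2`, which are incongruent modulo `n + 1`. Residue 2 exists because `2 ≤ n`.
    have h1 := (key 1 le_rfl (by omega)).resolve_left hne
    have h2 := (key 2 (by omega) hn).resolve_left hne
    have h3 := D.index_eq_iff.mp (h1.symm.trans h2)
    have := Int.le_of_dvd (by push_cast; omega) h3
    push_cast at this
    omega
  · rintro rfl v hv β hβ hβv
    obtain ⟨i, t, hi, hin, ht, htn, rfl, rfl⟩ := (D.hasFoldedCoord_iff hc).mp hβv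
    rw [hβ.isSummand_iff hp]
    exact (D.vertex_mem_snake hξ hi hin ht htn).mp hv

end SnakeData

end TwistedD

/-! ### The theorem -/

open TwistedD in
theorem theorem5p8 (n : ℕ) (hn : 2 ≤ n) (w : List ℕ) (hw : IsTwistedAdapted n w) :
    -- the class of `w` is given by a twisted Coxeter element
    (∃ c, IsTwistedCoxeterWord n c ∧ CommEquiv n w (twistedWord n c)) ∧
    ∀ c, IsTwistedCoxeterWord n c → CommEquiv n w (twistedWord n c) →
    ∀ ξ, IsHeight n c ξ →
      -- coordinates are well defined, and the folded quiver is labelled bijectively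
      (∀ β, IsPosRoot n β → ∃! x : ℕ × ℤ, HasCoord n c ξ β x.1 x.2) ∧
      (∀ β v, HasFoldedCoord n c ξ β v → IsPosRoot n β ∧ v ∈ shape n ξ) ∧
      (∀ v ∈ shape n ξ, ∃! β, HasFoldedCoord n c ξ β v) ∧
      -- the normalisation of the height function
      (∀ β v, HasFoldedCoord n c ξ β v →
        ((IsSummand n β ((n : ℤ) + 1) ∨ IsSummand n β (-((n : ℤ) + 1))) ↔
          (v.2 = (v.1 : ℤ) ∨ v.2 = -(v.1 : ℤ)))) ∧
      -- the `[p]`-snakes exist and exhaust the snakes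
      (∀ p ∈ Finset.Icc 1 (n + 1), ∃! m : ℤ, m ∈ Finset.Icc (0 : ℤ) n ∧ IsSnakeOf n c ξ p m) ∧
      (∀ m : ℤ, ∃! p : ℕ, p ∈ Finset.Icc 1 (n + 1) ∧ IsSnakeOf n c ξ p m) ∧
      -- a positive root has `p` or `-p` as a summand iff it lies in the `[p]`-snake
      (∀ p ∈ Finset.Icc 1 (n + 1), ∀ m : ℤ, IsSnakeOf n c ξ p m →
        ∀ β, IsPosRoot n β → ∀ v, HasFoldedCoord n c ξ β v →
          ((IsSummand n β p ∨ IsSummand n β (-(p : ℤ))) ↔ v ∈ snake n (shape n ξ) m)) ∧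
      -- the algorithm: the snake numbers and the labels are read off from the shape
      (∀ m : ℤ, IsSnakeOf n c ξ (snakeNumber n (shape n ξ) m) m) ∧
      (∀ β i p, HasCoord n c ξ β i p →
        β = signedEps (label n (shape n ξ) (decide (n ∈ c)) (fold n i, p)).1 +
            signedEps (label n (shape n ξ) (decide (n ∈ c)) (fold n i, p)).2) := by
  refine ⟨hw.exists_coxeter hn, fun c hc _ ξ hheight => ?_⟩
  have hξ := hheight.eq_halfHeight hc
  obtain ⟨E, e, D⟩ := exists_snakeData hn c
  have hn1 := D.one_le
  refine ⟨fun β hβ => D.existsUnique_coord hc hβ, fun β v h => ?_, fun v hv => ?_, fun β v h => ?_,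
    fun p hp => ?_, fun m => ?_, fun p hp m hm β hβ v hv => ?_, fun m => ?_, fun β i p h => ?_⟩
  · obtain ⟨i, t, hi, hin, ht, htn, rfl, rfl⟩ := (D.hasFoldedCoord_iff hc).mp h
    exact ⟨D.isPosRoot_root hi hin ht htn, mem_shape.mpr ⟨i, t, hi, hin, ht, htn, rfl⟩⟩
  · obtain ⟨i, t, hi, hin, ht, htn, rfl⟩ := mem_shape.mp hv
    refine ⟨_, (D.hasFoldedCoord_iff hc).mpr ⟨i, t, hi, hin, ht, htn, rfl, rfl⟩, fun β hβ => ?_⟩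
    obtain ⟨j, u, _, _, _, _, h, rfl⟩ := (D.hasFoldedCoord_iff hc).mp hβ
    rw [Prod.mk.injEq] at h
    obtain ⟨rfl, h⟩ := h
    rw [show u = t by omega]
  · obtain ⟨i, t, hi, hin, ht, htn, rfl, rfl⟩ := (D.hasFoldedCoord_iff hc).mp h
    have hz := D.index.zero hn1 D.height
    have hb := D.height.mem_range hi hin
    have h1 := (D.isPosRoot_root hi hin ht htn).isSummand_iff (p := n + 1) (by omega)
    push_cast at h1
    have h2 : e (0 % ((n : ℤ) + 1)) = n + 1 := by rw [Int.zero_emod, hz]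
    rw [h1, D.root_apply_ne_zero_iff hi hin, ← h2, D.index_eq_iff, D.index_eq_iff, hξ i hi hin]
    -- Both indices of a vertex lie in this open window, so index 0 is the only one carrying
    -- `±ε_{n+1}`; it occurs at `q = -i` on N-paths and at `q = i` on S-paths.
    have key : ∀ x : ℤ, -((n : ℤ) + 1) < x → x < (n : ℤ) + 1 →
        (((n : ℤ) + 1) ∣ 0 - x ↔ x = 0) := fun x hx hx' =>
      ⟨fun h => by
        have := Int.eq_zero_of_abs_lt_dvd h (by rw [abs_lt]; omega); omega,
        fun h => by rw [h]; simp⟩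
    rw [key _ (by omega) (by omega), key _ (by omega) (by omega)]
    simp only
    omega
  · rw [Finset.mem_Icc] at hp
    have hm := D.height.snakePos_mem hn1 hp.1 hp.2
    refine ⟨snakePos n (halfHeight n c) p, ⟨Finset.mem_Icc.mpr hm, ?_⟩, fun m' h => ?_⟩
    · rw [D.isSnakeOf_iff hc hξ hp.1, Int.emod_eq_of_lt hm.1 (by omega),
        D.index.apply_snakePos hn1 D.height hp.1 hp.2]
    · obtain ⟨h1, h2⟩ := h
      rw [Finset.mem_Icc] at h1
      rw [D.isSnakeOf_iff hc hξ hp.1, Int.emod_eq_of_lt h1.1 (by omega)] at h2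
      rw [h2, D.index.snakePos_eq hn1 D.height h1.1 h1.2]
  · have hm := D.index_mem m
    refine ⟨_, ⟨Finset.mem_Icc.mpr hm, (D.isSnakeOf_iff hc hξ hm.1 m).mpr rfl⟩, fun p hp => ?_⟩
    exact (D.isSnakeOf_iff hc hξ (Finset.mem_Icc.mp hp.1).1 m).mp hp.2
  · rw [Finset.mem_Icc] at hp
    obtain ⟨i, t, hi, hin, ht, htn, rfl, rfl⟩ := (D.hasFoldedCoord_iff hc).mp hv
    rw [hβ.isSummand_iff hp.1, D.vertex_mem_snake hξ hi hin ht htn,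
      ← (D.isSnakeOf_iff hc hξ hp.1 m).mp hm]
  · have hm := D.index_mem m
    rw [D.snakeNumber_eq hξ]
    exact (D.isSnakeOf_iff hc hξ hm.1 m).mpr rfl
  · obtain ⟨k, hk, t, ht, rfl, rfl, rfl⟩ := D.exists_of_hasCoord hc h
    have hf := hc.fold_mem hk
    rw [fold_vee_iterate]
    exact D.root_eq_label hξ (by simp [coxeterSign]) hf.1 hf.2 (by omega) (by omega)
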